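/- **Setting.** Let $M$ be an $n$-dimensional $C^\infty$ manifold, $\alpha=\sqrt{a_{ij}(x)y^iy^j}$ a smooth Riemannian metric and $\beta=b_i(x)y^i$ a smooth 1-form on $M$; put $b^i=a^{ij}b_j$ and $b^2=b^ib_i=\|\beta\|_\alpha^2$. Let $\phi$ be a $C^\infty$ function on an open set $J\subset\mathbb R$, and let $F=\alpha\,\phi(s)$, $s=\beta/\alpha$, be an $(\alpha,\beta)$-metric: on the set $\mathcal D$ of all tangent vectors $y\neq0$ with $s=\beta(y)/\alpha(y)\in J$ (where $F$ is defined) one has $$\phi(s)>0,\qquad \phi(s)-s\phi'(s)>0,\qquad \phi(s)-s\phi'(s)+(b^2-s^2)\phi''(s)>0 .$$ (For the usual regular $(\alpha,\beta)$-metrics $J=(-b_0,b_0)$ and $\|\beta\|_\alpha<b_0$, so that $\mathcal D$ consists of all nonzero vectors; for Kropina metrics $J=(0,\infty)$ and $\phi(s)=1/s$.) In local coordinates let $g_{ij}=\frac12\frac{\partial^2F^2}{\partial y^i\partial y^j}$, $G^i=\frac14g^{il}\big\{\frac{\partial^2F^2}{\partial x^k\partial y^l}y^k-\frac{\partial F^2}{\partial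 x^l}\big\}$, let $\mathbf S=\frac{\partial G^m}{\partial y^m}-y^m\frac{\partial}{\partial x^m}(\ln\sigma)$ be the S-curvature, where $\sigma(x)=\mathrm{Vol}(\mathbb B^n(1))/\mathrm{Vol}\{y\in\mathcal D_x: F(x,y)<1\}$ is the density of the Busemann–Hausdorff volume form, and let $E_{ij}=\frac12\frac{\partial^2\mathbf S}{\partial y^i\partial y^j}$ be the E-curvature. Put $$Q=\frac{\phi'}{\phi-s\phi'},\quad \Delta=1+sQ+(b^2-s^2)Q',\quad \Psi=\frac{Q'}{2\Delta},$$ $$\Phi=-(Q-sQ')\{n\Delta+1+sQ\}-(b^2-s^2)(1+sQ)Q'',\quad \Omega=\frac{\Phi}{2\Delta^2},$$ where primes are derivatives with respect to $s$ (with $b^2$ fixed). With $|$ the covariant derivative of $\alpha$, put $r_{ij}=\frac12(b_{i|j}+b_{j|i})$, $s_{ij}=\frac12(b_{i|j}-b_{j|i})$, $r_j=b^ir_{ij}$, $s_j=b^is_{ij}$, $r_{i0}=r_{ij}y^j$, $r_{00}=r_{ij}y^iy^j$, $r_0=r_jy^j$, $s_0=s_jy^j$, $y_i=a_{ij}y^j$.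 **Proposition 3.1.** In every chart of $M$ and at every $(x,y)\in\mathcal D$, $\mathbf S$ is $C^\infty$ in $y$ near $y$ and, for all $i,j$, $$\begin{aligned}E_{ij}={}&C_1b_ib_j+C_2(b_iy_j+b_jy_i)+C_3y_iy_j+C_4a_{ij}+C_5(r_{i0}b_j+r_{j0}b_i)+C_6(r_{i0}y_j+r_{j0}y_i)+C_7r_{ij}\\&+C_8(s_ib_j+s_jb_i)+C_9(s_iy_j+s_jy_i)+C_{10}(r_ib_j+r_jb_i)+C_{11}(r_iy_j+r_jy_i),\end{aligned}$$ where $$\begin{aligned} C_1&=\tfrac{1}{2\alpha^3\Delta^2}\{\Phi\alpha Q''s_0+2\alpha\Delta^2\Psi''r_0-\Delta^2\Omega''r_{00}+2\Delta^2\alpha\Omega''Qs_0+4\Delta^2\alpha\Omega'Q's_0+2\alpha\Delta^2\Psi''s_0\},\\ C_2&=\tfrac{-1}{2\alpha^4\Delta^2}\{2\alpha\Delta^2\Psi's_0-2\Omega'\Delta^2r_{00}+2\Omega'\Delta^2\alpha Qs_0-\Delta^2\Omega''sr_{00}+2\Delta^2\alpha\Omega''sQs_0+4\Delta^2\alpha\Omega'Q's_0s\\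 &\qquad+2\alpha\Delta^2\Psi'r_0+2\alpha\Delta^2\Psi''sr_0+2\alpha\Delta^2\Psi''ss_0+\Phi\alpha Q's_0+\Phi\alpha Q''s_0s\},\\ C_3&=\tfrac{1}{4\alpha^5\Delta^2}\{4\Delta^2s^2\Omega''\alpha Qs_0-2\Delta^2s^2\Omega''r_{00}+12\alpha\Delta^2\Psi'sr_0+12\alpha\Delta^2\Psi'ss_0+4\alpha\Delta^2\Psi''s^2r_0+4\alpha\Delta^2\Psi''s^2s_0\\ &\qquad+8\Delta^2s^2\Omega'\alpha Q's_0+2\Phi\alpha Q''s_0s^2-10\Omega'\Delta^2sr_{00}+12\Omega'\Delta^2s\alpha Qs_0+6\Phi\alpha Q's_0s-3\Phi r_{00}\},\\ C_4&=\tfrac{-1}{4\alpha^3\Delta^2}\{4\alpha\Delta^2\Psi'ss_0-\Phi r_{00}-2\Omega'\Delta^2sr_{00}+4\Omega'\Delta^2s\alpha Qs_0+4\alpha\Delta^2\Psi'sr_0+2\Phi\alpha Q's_0s\},\\ C_5&=\tfrac{-\Omega'}{\alpha^2},\quad C_6=\tfrac{2\Delta^2s\Omega'+\Phi}{2\alpha^3\Delta^2},\quad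 C_7=\tfrac{-\Phi}{2\alpha\Delta^2},\quad C_8=\tfrac{1}{2\alpha\Delta^2}\{2\Omega'\Delta^2Q+2\Delta^2\Psi'+\Phi Q'\},\\ C_9&=\tfrac{-s}{\alpha}C_8,\quad C_{10}=\tfrac{\Psi'}{\alpha},\quad C_{11}=\tfrac{-s}{\alpha}C_{10}. \end{aligned}$$ -/

import Mathlib

open scoped Manifold ContDiff Bundle

noncomputable section

namespace AlphaBeta

/-! ### Finsler functions in local coordinates

`L u y` is the value of a Finsler function at the point with coordinates `u` on the vector with
components `y`. -/

section Local

variable {n : ℕ}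

/-- The partial derivative of `f` in the `i`-th coordinate at `x`. -/
def pd (i : Fin n) (f : EuclideanSpace ℝ (Fin n) → ℝ) (x : EuclideanSpace ℝ (Fin n)) : ℝ :=
  fderiv ℝ f x (EuclideanSpace.single i 1)

/-- The fundamental tensor `g_ij = (1/2) ∂²(L²)/∂y^i∂y^j`. -/
def fundamentalTensor (L : EuclideanSpace ℝ (Fin n) → EuclideanSpace ℝ (Fin n) → ℝ)
    (u y : EuclideanSpace ℝ (Fin n)) : Matrix (Fin n) (Fin n) ℝ :=
  Matrix.of fun i j => 1 / 2 * pd i (fun y' => pd j (fun y'' => L u y'' ^ 2) y') y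

/-- The spray coefficients
`G^i = (1/4) g^{il} (∂²(L²)/∂x^k∂y^l y^k - ∂(L²)/∂x^l)`. -/
def sprayCoeff (L : EuclideanSpace ℝ (Fin n) → EuclideanSpace ℝ (Fin n) → ℝ)
    (u y : EuclideanSpace ℝ (Fin n)) (i : Fin n) : ℝ :=
  1 / 4 * ∑ l, (fundamentalTensor L u y)⁻¹ i l *
    ((∑ k, pd k (fun u' => pd l (fun y' => L u' y' ^ 2) y) u * y k)
      - pd l (fun u' => L u' y ^ 2) u)

/-- The density `σ` of the Busemann-Hausdorff volume form `σ dx`: the volume of the Euclidean unit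
ball divided by the volume of the Finsler unit ball. Here `D u` is the set of vectors at `u` on
which the Finsler function is defined. -/
def bhDensity (D : EuclideanSpace ℝ (Fin n) → Set (EuclideanSpace ℝ (Fin n)))
    (L : EuclideanSpace ℝ (Fin n) → EuclideanSpace ℝ (Fin n) → ℝ)
    (u : EuclideanSpace ℝ (Fin n)) : ℝ :=
  (MeasureTheory.volume (Metric.ball (0 : EuclideanSpace ℝ (Fin n)) 1)).toReal /
    (MeasureTheory.volume {y | y ∈ D u ∧ L u y < 1}).toReal

/-- The S-curvature `S = ∂G^m/∂y^m - y^m ∂(ln σ)/∂x^m` of the Busemann-Hausdorff volume form. -/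
def sCurv (D : EuclideanSpace ℝ (Fin n) → Set (EuclideanSpace ℝ (Fin n)))
    (L : EuclideanSpace ℝ (Fin n) → EuclideanSpace ℝ (Fin n) → ℝ)
    (u y : EuclideanSpace ℝ (Fin n)) : ℝ :=
  (∑ m, pd m (fun y' => sprayCoeff L u y' m) y)
    - ∑ m, y m * pd m (fun u' => Real.log (bhDensity D L u')) u

/-- The E-curvature `E_ij = (1/2) ∂²S/∂y^i∂y^j`. -/
def eCurv (D : EuclideanSpace ℝ (Fin n) → Set (EuclideanSpace ℝ (Fin n)))
    (L : EuclideanSpace ℝ (Fin n) → EuclideanSpace ℝ (Fin n) → ℝ)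
    (u y : EuclideanSpace ℝ (Fin n)) (i j : Fin n) : ℝ :=
  1 / 2 * pd i (fun y' => pd j (fun y'' => sCurv D L u y'') y') y

/-! ### Tensors built from the components `a_ij` of `α` and `b_i` of `β` -/

/-- The Christoffel symbols `Γ^k_ij` of `a`. -/
def christoffel (a : EuclideanSpace ℝ (Fin n) → Matrix (Fin n) (Fin n) ℝ)
    (u : EuclideanSpace ℝ (Fin n)) (k i j : Fin n) : ℝ :=
  1 / 2 * ∑ l, (a u)⁻¹ k l *
    (pd j (fun u' => a u' l i) u + pd i (fun u' => a u' l j) u - pd l (fun u' => a u' i j) u)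

/-- The covariant derivative `b_{i|j}`; the last index is the one of differentiation. -/
def covDeriv (a : EuclideanSpace ℝ (Fin n) → Matrix (Fin n) (Fin n) ℝ)
    (b : EuclideanSpace ℝ (Fin n) → Fin n → ℝ)
    (u : EuclideanSpace ℝ (Fin n)) (i j : Fin n) : ℝ :=
  pd j (fun u' => b u' i) u - ∑ k, christoffel a u k i j * b u k

/-- `b^i = a^{ij} b_j`. -/
def bUp (a : EuclideanSpace ℝ (Fin n) → Matrix (Fin n) (Fin n) ℝ)
    (b : EuclideanSpace ℝ (Fin n) → Fin n → ℝ)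
    (u : EuclideanSpace ℝ (Fin n)) (i : Fin n) : ℝ :=
  ∑ j, (a u)⁻¹ i j * b u j

/-- `b² = b^i b_i`, the squared norm of `β` with respect to `α`. -/
def normSq (a : EuclideanSpace ℝ (Fin n) → Matrix (Fin n) (Fin n) ℝ)
    (b : EuclideanSpace ℝ (Fin n) → Fin n → ℝ) (u : EuclideanSpace ℝ (Fin n)) : ℝ :=
  ∑ i, bUp a b u i * b u i

/-- `r_ij = (b_{i|j} + b_{j|i}) / 2`. -/
def rTensor (a : EuclideanSpace ℝ (Fin n) → Matrix (Fin n) (Fin n) ℝ)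
    (b : EuclideanSpace ℝ (Fin n) → Fin n → ℝ)
    (u : EuclideanSpace ℝ (Fin n)) (i j : Fin n) : ℝ :=
  1 / 2 * (covDeriv a b u i j + covDeriv a b u j i)

/-- `s_ij = (b_{i|j} - b_{j|i}) / 2`. -/
def sTensor (a : EuclideanSpace ℝ (Fin n) → Matrix (Fin n) (Fin n) ℝ)
    (b : EuclideanSpace ℝ (Fin n) → Fin n → ℝ)
    (u : EuclideanSpace ℝ (Fin n)) (i j : Fin n) : ℝ :=
  1 / 2 * (covDeriv a b u i j - covDeriv a b u j i)

/-- `r_j = b^i r_ij`. -/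
def rForm (a : EuclideanSpace ℝ (Fin n) → Matrix (Fin n) (Fin n) ℝ)
    (b : EuclideanSpace ℝ (Fin n) → Fin n → ℝ)
    (u : EuclideanSpace ℝ (Fin n)) (j : Fin n) : ℝ :=
  ∑ i, bUp a b u i * rTensor a b u i j

/-- `s_j = b^i s_ij`. -/
def sForm (a : EuclideanSpace ℝ (Fin n) → Matrix (Fin n) (Fin n) ℝ)
    (b : EuclideanSpace ℝ (Fin n) → Fin n → ℝ)
    (u : EuclideanSpace ℝ (Fin n)) (j : Fin n) : ℝ :=
  ∑ i, bUp a b u i * sTensor a b u i j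

end Local

/-! ### Functions of `s` attached to `φ`

`B` stands for `b²`; it is a constant for differentiation in `s`. -/

section Scalar

variable (n : ℕ) (φ : ℝ → ℝ) (B : ℝ)

/-- `Q = φ' / (φ - s φ')`. -/
def Q (s : ℝ) : ℝ := deriv φ s / (φ s - s * deriv φ s)

/-- `Δ = 1 + s Q + (b² - s²) Q'`. -/
def Delta (s : ℝ) : ℝ := 1 + s * Q φ s + (B - s ^ 2) * deriv (Q φ) s

/-- `Ψ = Q' / (2 Δ)`. -/
def Psi (s : ℝ) : ℝ := deriv (Q φ) s / (2 * Delta φ B s)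

/-- `Φ = -(Q - s Q') (n Δ + 1 + s Q) - (b² - s²) (1 + s Q) Q''`. -/
def Phi (s : ℝ) : ℝ :=
  -(Q φ s - s * deriv (Q φ) s) * (n * Delta φ B s + 1 + s * Q φ s)
    - (B - s ^ 2) * (1 + s * Q φ s) * deriv (deriv (Q φ)) s

/-- `Ω = Φ / (2 Δ²)`. -/
def Omega (s : ℝ) : ℝ := Phi n φ B s / (2 * Delta φ B s ^ 2)

end Scalar

/-! ### `(α, β)`-metrics on manifolds -/

section Manifold

variable {n : ℕ} {M : Type*} [TopologicalSpace M] [ChartedSpace (EuclideanSpace ℝ (Fin n)) M]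
  [IsManifold (𝓡 n) ∞ M]

/-- Smooth Riemannian metrics on `M`. -/
abbrev SmoothMetric (n : ℕ) (M : Type*) [TopologicalSpace M]
    [ChartedSpace (EuclideanSpace ℝ (Fin n)) M] [IsManifold (𝓡 n) ∞ M] :=
  Bundle.ContMDiffRiemannianMetric (𝓡 n) ∞ (EuclideanSpace ℝ (Fin n))
    (fun p : M => TangentSpace (𝓡 n) p)

/-- Smoothness of a 1-form, as a section of the cotangent bundle. -/
def IsSmoothForm (β : (p : M) → TangentSpace (𝓡 n) p →L[ℝ] ℝ) : Prop :=
  ContMDiff (𝓡 n) ((𝓡 n).prod 𝓘(ℝ, EuclideanSpace ℝ (Fin n) →L[ℝ] ℝ)) ∞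
    (fun p => Bundle.TotalSpace.mk' (EuclideanSpace ℝ (Fin n) →L[ℝ] ℝ)
      (E := fun p : M => TangentSpace (𝓡 n) p →L[ℝ] Bundle.Trivial M ℝ p) p (β p))

variable (g : SmoothMetric n M) (β : (p : M) → TangentSpace (𝓡 n) p →L[ℝ] ℝ)
  (φ : ℝ → ℝ) (J : Set ℝ)

/-- `α(v)`, the Riemannian length of `v`. -/
def alpha (p : M) (v : TangentSpace (𝓡 n) p) : ℝ := Real.sqrt (g.inner p v v)

/-- `F = α φ(β / α)`. -/
def finsler (p : M) (v : TangentSpace (𝓡 n) p) : ℝ :=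
  alpha g p v * φ (β p v / alpha g p v)

/-- The set of tangent vectors at `p` on which `F = α φ(β / α)` is defined and smooth, where `J` is
the domain of `φ`. -/
def finslerDomain (p : M) : Set (TangentSpace (𝓡 n) p) :=
  {v | v ≠ 0 ∧ β p v / alpha g p v ∈ J}

/-- `F = α φ(β / α)` is an `(α, β)`-metric: `φ` is smooth on the open set `J`, and the regularity
conditions `φ > 0`, `φ - s φ' > 0`, `φ - s φ' + (b² - s²) φ'' > 0` (which make the fundamental
tensor of `F` positive definite) hold at `s = β(v) / α(v)`, for every `v` in the domain of `F`.
The usual regular metrics have `J = (-b₀, b₀)` and `b = ‖β‖_α < b₀`; Kropina metrics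
`α² / β` have `J = (0, ∞)`.

At every `p` there is exactly one vector `w` that is `α`-dual to `β`, and `β p w = b²`. -/
structure IsAlphaBetaMetric : Prop where
  smooth_form : IsSmoothForm β
  isOpen_dom : IsOpen J
  smooth_phi : ContDiffOn ℝ ∞ φ J
  phi_pos : ∀ (p : M), ∀ v ∈ finslerDomain g β J p, 0 < φ (β p v / alpha g p v)
  regular : ∀ (p : M), ∀ v ∈ finslerDomain g β J p, ∀ s : ℝ, s = β p v / alpha g p v →
    0 < φ s - s * deriv φ s
  strong_convex : ∀ (p : M), ∀ v ∈ finslerDomain g β J p, ∀ s : ℝ, s = β p v / alpha g p v →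
    ∀ w : TangentSpace (𝓡 n) p, (∀ z : TangentSpace (𝓡 n) p, g.inner p w z = β p z) →
      0 < φ s - s * deriv φ s + (β p w - s ^ 2) * deriv (deriv φ) s

/-- The tangent vector `y^i ∂/∂x^i` at the point with coordinates `u` in the chart `e`. -/
def coordVec (e : OpenPartialHomeomorph M (EuclideanSpace ℝ (Fin n)))
    (u y : EuclideanSpace ℝ (Fin n)) : TangentSpace (𝓡 n) (e.symm u) :=
  mfderiv (𝓡 n) (𝓡 n) e.symm u y

/-- The components `a_ij` of `α` in the chart `e`. -/
def coordA (e : OpenPartialHomeomorph M (EuclideanSpace ℝ (Fin n)))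
    (u : EuclideanSpace ℝ (Fin n)) : Matrix (Fin n) (Fin n) ℝ :=
  Matrix.of fun i j => g.inner (e.symm u)
    (coordVec e u (EuclideanSpace.single i 1)) (coordVec e u (EuclideanSpace.single j 1))

/-- The components `b_i` of `β` in the chart `e`. -/
def coordB (e : OpenPartialHomeomorph M (EuclideanSpace ℝ (Fin n)))
    (u : EuclideanSpace ℝ (Fin n)) (i : Fin n) : ℝ :=
  β (e.symm u) (coordVec e u (EuclideanSpace.single i 1))

/-- `F` as a function of the coordinates `(x, y)` of `TM` induced by the chart `e`. -/
def coordF (e : OpenPartialHomeomorph M (EuclideanSpace ℝ (Fin n)))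
    (u y : EuclideanSpace ℝ (Fin n)) : ℝ :=
  finsler g β φ (e.symm u) (coordVec e u y)

/-- The domain of `F` in the coordinates `(x, y)` of `TM` induced by the chart `e`. -/
def coordDomain (e : OpenPartialHomeomorph M (EuclideanSpace ℝ (Fin n)))
    (u : EuclideanSpace ℝ (Fin n)) : Set (EuclideanSpace ℝ (Fin n)) :=
  {y | coordVec e u y ∈ finslerDomain g β J (e.symm u)}

end Manifold

end AlphaBeta

end

open scoped Matrix

noncomputable section

namespace AlphaBeta

/-! ### Coordinate expressions of the metric and the form in a chart. -/

section Chart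

variable {n : ℕ} {M : Type*} [TopologicalSpace M] [ChartedSpace (EuclideanSpace ℝ (Fin n)) M]

/-! The E-curvature is half the Hessian in `y` of `S`, so every part of `S` that is linear in `y`
can be discarded. The density `σ` enters only through `y^m ∂_m ln σ`, which for fixed `x` is linear
in `y`; hence nothing about `σ` has to be computed. The spray of `α` has divergence `Γ^m_{mj} y^j`,
also linear. What remains is the divergence of the difference `D` of the two sprays.

With `R = r₀₀ - 2αQ s₀` and `Θ = (Q - sQ') / (2Δ)`, this difference is `D^i = αQ s^i_0 + Θ R y^i / α
+ Ψ R b^i` (`sprayDiff`). It is verified rather than derived. The fundamental tensor is a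
combination of `a_ij`, `y_i y_j`, `b_i b_j` and `b_i y_j + b_j y_i` (`fundamentalTensor_abMetric`),
so applying it to the candidate spray reduces the defining equation to three scalar identities, for
the coefficients of `s_{l0}`, `y_l` and `b_l` (`wA_mul_Q`, `wA_mul_Theta`, `wA_mul_Psi`). The
regularity conditions make the tensor invertible (`isUnit_det_fundamentalTensor`), and
`sprayCoeff_abMetric` follows.

The divergence of `D` collapses to `2Ψ(r₀ + s₀) - Ω(r₀₀/α - 2Q s₀)` (`sum_pd_sprayDiff`), by `(n+1)Θ
+ (b² - s²)Ψ' = -Ω` and `2ΨΔ = Q'`. This function is smooth where the regularity conditions hold.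
Its Hessian follows from those of `s` and `r₀₀/α` (`hasHess_sCurvMain`), and collecting terms gives
the eleven coefficients (`sCurvHess_eq`). -/

theorem coordVec_eq_sum (e : OpenPartialHomeomorph M (EuclideanSpace ℝ (Fin n)))
    (u y : EuclideanSpace ℝ (Fin n)) :
    coordVec e u y = ∑ i, y i • coordVec e u (EuclideanSpace.single i 1) := by
  have hy : y = ∑ i, y i • EuclideanSpace.single i (1 : ℝ) := by
    ext k
    simp [Finset.sum_apply, Pi.single_apply]
  conv_lhs => rw [hy]
  unfold coordVec
  exact (map_sum (mfderiv (𝓡 n) (𝓡 n) e.symm u) _ _).trans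
    (Finset.sum_congr rfl fun i _ => map_smul (mfderiv (𝓡 n) (𝓡 n) e.symm u) _ _)

theorem mdifferentiable_of_mem_maximalAtlas
    {e : OpenPartialHomeomorph M (EuclideanSpace ℝ (Fin n))}
    (he : e ∈ IsManifold.maximalAtlas (𝓡 n) ∞ M) : e.MDifferentiable (𝓡 n) (𝓡 n) :=
  ⟨(contMDiffOn_of_mem_maximalAtlas he).mdifferentiableOn (by simp),
    (contMDiffOn_symm_of_mem_maximalAtlas he).mdifferentiableOn (by simp)⟩

theorem form_coordVec (β : (p : M) → TangentSpace (𝓡 n) p →L[ℝ] ℝ)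
    (e : OpenPartialHomeomorph M (EuclideanSpace ℝ (Fin n)))
    (u y : EuclideanSpace ℝ (Fin n)) :
    β (e.symm u) (coordVec e u y) = ∑ i, coordB β e u i * y i := by
  rw [coordVec_eq_sum e u y]
  simp only [map_sum, map_smul, smul_eq_mul, coordB]
  exact Finset.sum_congr rfl fun i _ => by ring

theorem coordVec_bijective {e : OpenPartialHomeomorph M (EuclideanSpace ℝ (Fin n))}
    (he : e ∈ IsManifold.maximalAtlas (𝓡 n) ∞ M) {u : EuclideanSpace ℝ (Fin n)}
    (hu : u ∈ e.target) : Function.Bijective (coordVec e u) :=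
  (mdifferentiable_of_mem_maximalAtlas he).symm.mfderiv_bijective hu

theorem coordVec_ne_zero {e : OpenPartialHomeomorph M (EuclideanSpace ℝ (Fin n))}
    (he : e ∈ IsManifold.maximalAtlas (𝓡 n) ∞ M) {u : EuclideanSpace ℝ (Fin n)}
    (hu : u ∈ e.target) {y : EuclideanSpace ℝ (Fin n)} : coordVec e u y ≠ 0 ↔ y ≠ 0 := by
  have h0 : coordVec e u 0 = 0 := map_zero (mfderiv (𝓡 n) (𝓡 n) e.symm u)
  rw [← h0, (coordVec_bijective he hu).1.ne_iff]

variable [IsManifold (𝓡 n) ∞ M]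

theorem inner_coordVec (g : SmoothMetric n M)
    (e : OpenPartialHomeomorph M (EuclideanSpace ℝ (Fin n)))
    (u y z : EuclideanSpace ℝ (Fin n)) :
    g.inner (e.symm u) (coordVec e u y) (coordVec e u z) =
      ∑ i, ∑ j, coordA g e u i j * y i * z j := by
  rw [coordVec_eq_sum e u y, coordVec_eq_sum e u z]
  simp only [map_sum, map_smul, sum_apply, smul_apply,
    smul_eq_mul, coordA, Matrix.of_apply, Finset.mul_sum]
  rw [Finset.sum_comm]
  exact Finset.sum_congr rfl fun i _ => Finset.sum_congr rfl fun j _ => by ring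

theorem coordF_eq (g : SmoothMetric n M) (β : (p : M) → TangentSpace (𝓡 n) p →L[ℝ] ℝ)
    (φ : ℝ → ℝ) (e : OpenPartialHomeomorph M (EuclideanSpace ℝ (Fin n)))
    (u y : EuclideanSpace ℝ (Fin n)) :
    coordF g β φ e u y =
      Real.sqrt (∑ i, ∑ j, coordA g e u i j * y i * y j) *
        φ ((∑ i, coordB β e u i * y i) /
          Real.sqrt (∑ i, ∑ j, coordA g e u i j * y i * y j)) := by
  simp only [coordF, finsler, alpha, inner_coordVec, form_coordVec]

theorem coordA_symm (g : SmoothMetric n M)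
    (e : OpenPartialHomeomorph M (EuclideanSpace ℝ (Fin n)))
    (u : EuclideanSpace ℝ (Fin n)) (i j : Fin n) : coordA g e u i j = coordA g e u j i := by
  simp only [coordA, Matrix.of_apply]
  exact g.symm _ _ _

section

variable {e : OpenPartialHomeomorph M (EuclideanSpace ℝ (Fin n))}
  (he : e ∈ IsManifold.maximalAtlas (𝓡 n) ∞ M) {u : EuclideanSpace ℝ (Fin n)} (hu : u ∈ e.target)

include he hu

/-- A coordinate field with constant components is the tangent map of `e.symm` applied to a constant
section. Class `C¹` suffices: only first `x`-derivatives of `a_ij` and `b_i` enter the spray. -/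
theorem contMDiffAt_coordVec (y : EuclideanSpace ℝ (Fin n)) :
    ContMDiffAt (𝓡 n) ((𝓡 n).prod (𝓡 n)) 1
      (fun u' => Bundle.TotalSpace.mk' (EuclideanSpace ℝ (Fin n))
        (E := fun p : M => TangentSpace (𝓡 n) p) (e.symm u') (coordVec e u' y)) u := by
  have h1 : ContMDiffOn (𝓡 n) (𝓡 n) ∞ e.symm e.target := contMDiffOn_symm_of_mem_maximalAtlas he
  have h2 := h1.contMDiffOn_tangentMapWithin (m := 1) (by decide) e.open_target.uniqueMDiffOn
  have h3 : ContMDiffAt (𝓡 n) ((𝓡 n).prod (𝓡 n)) 1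
      (fun u' : EuclideanSpace ℝ (Fin n) =>
        (⟨u', y⟩ : TangentBundle (𝓡 n) (EuclideanSpace ℝ (Fin n)))) u :=
    contMDiffAt_vectorSpace_iff_contDiffAt.2 contDiffAt_const
  have h4 := (h2.contMDiffAt (x := ⟨u, y⟩)
    ((e.open_target.preimage (FiberBundle.continuous_proj _ _)).mem_nhds hu)).comp u h3
  refine h4.congr_of_eventuallyEq ?_
  filter_upwards [e.open_target.mem_nhds hu] with v hv
  simp only [Function.comp_apply, tangentMapWithin, coordVec,
    mfderivWithin_of_isOpen e.open_target hv]

theorem differentiableAt_coordA (g : SmoothMetric n M) (i j : Fin n) :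
    DifferentiableAt ℝ (fun u' => coordA g e u' i j) u := by
  have h1 := (g.contMDiff.contMDiffAt (x := e.symm u)).of_le (n := ∞) (m := 1) (by simp)
  have h2 : ContMDiffAt (𝓡 n) (𝓡 n) 1 e.symm u :=
    ((contMDiffOn_symm_of_mem_maximalAtlas he).contMDiffAt
      (e.open_target.mem_nhds hu)).of_le (by simp)
  have h3 := ContMDiffAt.clm_bundle_apply₂ (F₃ := ℝ) (E₃ := Bundle.Trivial M ℝ) (h1.comp u h2)
    (contMDiffAt_coordVec he hu (EuclideanSpace.single i 1))
    (contMDiffAt_coordVec he hu (EuclideanSpace.single j 1))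
  rw [Bundle.contMDiffAt_totalSpace] at h3
  exact (contMDiffAt_iff_contDiffAt.1 h3.2).differentiableAt (by simp)

theorem differentiableAt_coordB {β : (p : M) → TangentSpace (𝓡 n) p →L[ℝ] ℝ}
    (hβ : IsSmoothForm β) (i : Fin n) :
    DifferentiableAt ℝ (fun u' => coordB β e u' i) u := by
  have h1 := (hβ.contMDiffAt (x := e.symm u)).of_le (n := ∞) (m := 1) (by simp)
  have h2 : ContMDiffAt (𝓡 n) (𝓡 n) 1 e.symm u :=
    ((contMDiffOn_symm_of_mem_maximalAtlas he).contMDiffAt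
      (e.open_target.mem_nhds hu)).of_le (by simp)
  have h3 := ContMDiffAt.clm_bundle_apply (F₂ := ℝ) (E₂ := Bundle.Trivial M ℝ) (h1.comp u h2)
    (contMDiffAt_coordVec he hu (EuclideanSpace.single i 1))
  rw [Bundle.contMDiffAt_totalSpace] at h3
  exact (contMDiffAt_iff_contDiffAt.1 h3.2).differentiableAt (by simp)

theorem coordA_pos (g : SmoothMetric n M) {y : EuclideanSpace ℝ (Fin n)} (hy : y ≠ 0) :
    0 < ∑ i, ∑ j, coordA g e u i j * y i * y j := by
  rw [← inner_coordVec]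
  exact g.pos _ _ ((coordVec_ne_zero he hu).2 hy)

end

end Chart

/-! ### Calculus of gradients and Hessians in coordinates. -/

section Gradient

variable {n : ℕ}

/-- The linear functional with coefficients `c`. -/
def lin (c : Fin n → ℝ) : EuclideanSpace ℝ (Fin n) →L[ℝ] ℝ :=
  ∑ i, c i • EuclideanSpace.proj i

theorem lin_apply (c : Fin n → ℝ) (v : EuclideanSpace ℝ (Fin n)) :
    lin c v = ∑ i, c i * v i := by
  simp [lin]

theorem lin_single (c : Fin n → ℝ) (i : Fin n) : lin c (EuclideanSpace.single i 1) = c i := by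
  simp [lin_apply]

theorem ext_single {f g : EuclideanSpace ℝ (Fin n) →L[ℝ] ℝ}
    (h : ∀ i, f (EuclideanSpace.single i 1) = g (EuclideanSpace.single i 1)) : f = g := by
  ext v
  have hv : v = ∑ i, v i • EuclideanSpace.single i (1 : ℝ) := by
    ext k
    simp [Finset.sum_apply, Pi.single_apply]
  rw [hv]
  simp only [map_sum, map_smul, h]

/-- `f` is differentiable at `x`, with gradient `c` in coordinates. -/
def HasGrad (f : EuclideanSpace ℝ (Fin n) → ℝ) (c : Fin n → ℝ) (x : EuclideanSpace ℝ (Fin n)) :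
    Prop :=
  HasFDerivAt f (lin c) x

namespace HasGrad

variable {f g : EuclideanSpace ℝ (Fin n) → ℝ} {c d : Fin n → ℝ} {x : EuclideanSpace ℝ (Fin n)}

theorem pd_eq (h : HasGrad f c x) (i : Fin n) : pd i f x = c i := by
  rw [pd, HasFDerivAt.fderiv h, lin_single]

theorem of_hasFDerivAt {f' : EuclideanSpace ℝ (Fin n) →L[ℝ] ℝ} (h : HasFDerivAt f f' x)
    (hc : ∀ i, f' (EuclideanSpace.single i 1) = c i) : HasGrad f c x := by
  rwa [HasGrad, ← ext_single fun i => (hc i).trans (lin_single c i).symm]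

theorem _root_.DifferentiableAt.hasGrad (h : DifferentiableAt ℝ f x) :
    HasGrad f (fun i => pd i f x) x :=
  of_hasFDerivAt h.hasFDerivAt fun _ => rfl

theorem continuousAt (h : HasGrad f c x) : ContinuousAt f x :=
  HasFDerivAt.continuousAt h

theorem congr (h : HasGrad f c x) (hc : ∀ i, c i = d i) : HasGrad f d x := by
  rwa [← funext hc]

theorem congr_eventually (h : HasGrad f c x) (hg : g =ᶠ[nhds x] f) : HasGrad g c x :=
  HasFDerivAt.congr_of_eventuallyEq h hg

theorem const (r : ℝ) : HasGrad (fun _ => r) (fun _ => 0) x :=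
  of_hasFDerivAt (hasFDerivAt_const r x) fun _ => rfl

theorem coord (j : Fin n) :
    HasGrad (fun y : EuclideanSpace ℝ (Fin n) => y j) (fun i => if j = i then 1 else 0) x :=
  of_hasFDerivAt (EuclideanSpace.proj (𝕜 := ℝ) j).hasFDerivAt fun i => by
    simp

theorem add (hf : HasGrad f c x) (hg : HasGrad g d x) :
    HasGrad (fun y => f y + g y) (fun i => c i + d i) x :=
  of_hasFDerivAt (HasFDerivAt.fun_add hf hg) fun i => by simp [lin_single]

theorem sub (hf : HasGrad f c x) (hg : HasGrad g d x) :
    HasGrad (fun y => f y - g y) (fun i => c i - d i) x :=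
  of_hasFDerivAt (HasFDerivAt.fun_sub hf hg) fun i => by simp [lin_single]

theorem mul (hf : HasGrad f c x) (hg : HasGrad g d x) :
    HasGrad (fun y => f y * g y) (fun i => f x * d i + g x * c i) x :=
  of_hasFDerivAt (HasFDerivAt.fun_mul hf hg) fun i => by simp [lin_single]

theorem const_mul (r : ℝ) (hf : HasGrad f c x) :
    HasGrad (fun y => r * f y) (fun i => r * c i) x :=
  ((const r).mul hf).congr fun i => by ring

theorem mul_const (r : ℝ) (hf : HasGrad f c x) :
    HasGrad (fun y => f y * r) (fun i => c i * r) x :=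
  (hf.mul (const r)).congr fun i => by ring

theorem sum {ι : Type*} {s : Finset ι} {f : ι → EuclideanSpace ℝ (Fin n) → ℝ}
    {c : ι → Fin n → ℝ} (h : ∀ k ∈ s, HasGrad (f k) (c k) x) :
    HasGrad (fun y => ∑ k ∈ s, f k y) (fun i => ∑ k ∈ s, c k i) x :=
  of_hasFDerivAt (HasFDerivAt.fun_sum h) fun i => by
    simp [lin_single, sum_apply]

theorem comp {F : ℝ → ℝ} {F' : ℝ} (hF : HasDerivAt F F' (f x)) (hf : HasGrad f c x) :
    HasGrad (fun y => F (f y)) (fun i => F' * c i) x :=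
  of_hasFDerivAt (hF.comp_hasFDerivAt x hf) fun i => by simp [lin_single]

/-- The quotient `f / g` is kept whole in the gradient, so that for `β / α` the variable `s`
reappears as such. -/
theorem div (hf : HasGrad f c x) (hg : HasGrad g d x) (h0 : g x ≠ 0) :
    HasGrad (fun y => f y / g y) (fun i => (c i - f x / g x * d i) / g x) x := by
  simp only [div_eq_mul_inv (f _)]
  refine (hf.mul (comp (hasDerivAt_inv h0) hg)).congr fun i => ?_
  field_simp
  ring

theorem sqrt (hf : HasGrad f c x) (h0 : 0 < f x) :
    HasGrad (fun y => Real.sqrt (f y)) (fun i => c i / (2 * Real.sqrt (f x))) x :=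
  (comp (Real.hasDerivAt_sqrt h0.ne') hf).congr fun i => by ring

theorem linear (b : Fin n → ℝ) : HasGrad (fun y => ∑ i, b i * y i) b x :=
  (sum fun i _ => (coord i).const_mul (b i)).congr fun i => by simp

theorem quadratic (a : Fin n → Fin n → ℝ) :
    HasGrad (fun y => ∑ i, ∑ j, a i j * y i * y j)
      (fun k => ∑ j, (a k j + a j k) * x j) x := by
  refine (sum fun i _ => sum fun j _ => ((coord i).const_mul (a i j)).mul (coord j)).congr
    fun k => ?_
  simp only [Finset.sum_add_distrib, add_mul, mul_ite, mul_one, mul_zero, Finset.sum_ite_eq',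
    Finset.mem_univ, if_true]
  rw [add_comm]
  congr 1
  · rw [Finset.sum_comm]
    simp [mul_comm]

end HasGrad

theorem pd_congr {f g : EuclideanSpace ℝ (Fin n) → ℝ} {x : EuclideanSpace ℝ (Fin n)}
    (h : f =ᶠ[nhds x] g) (i : Fin n) : pd i f x = pd i g x := by
  rw [pd, pd, h.fderiv_eq]

/-- `f` is twice differentiable at `x`, with gradient `c` and Hessian `h` in coordinates. -/
def HasHess (f : EuclideanSpace ℝ (Fin n) → ℝ) (c : Fin n → ℝ) (h : Fin n → Fin n → ℝ)
    (x : EuclideanSpace ℝ (Fin n)) : Prop :=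
  ∃ G : EuclideanSpace ℝ (Fin n) → Fin n → ℝ, (∀ᶠ y in nhds x, HasGrad f (G y) y) ∧ G x = c ∧
    ∀ j, HasGrad (fun y => G y j) (h j) x

namespace HasHess

variable {f g : EuclideanSpace ℝ (Fin n) → ℝ} {c d : Fin n → ℝ} {h k : Fin n → Fin n → ℝ}
  {x : EuclideanSpace ℝ (Fin n)}

theorem hasGrad (hf : HasHess f c h x) : HasGrad f c x := by
  obtain ⟨G, h1, rfl, -⟩ := hf
  exact h1.self_of_nhds

/-- The first index of the Hessian belongs to the inner derivative, hence the transposed indices. -/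
theorem pd_pd_eq (hf : HasHess f c h x) (i j : Fin n) :
    pd i (fun y => pd j f y) x = h j i := by
  obtain ⟨G, h1, -, h2⟩ := hf
  rw [pd_congr (g := fun y => G y j) (h1.mono fun y hy => hy.pd_eq j), (h2 j).pd_eq]

theorem congr (hf : HasHess f c h x) (hc : ∀ i, c i = d i) (hh : ∀ i j, h i j = k i j) :
    HasHess f d k x := by
  rwa [← funext hc, ← funext fun i => funext (hh i)]

theorem linear (b : Fin n → ℝ) : HasHess (fun y => ∑ i, b i * y i) b (fun _ _ => 0) x :=
  ⟨fun _ => b, .of_forall fun _ => .linear b, rfl, fun _ => .const _⟩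

theorem quadratic (a : Fin n → Fin n → ℝ) :
    HasHess (fun y => ∑ i, ∑ j, a i j * y i * y j) (fun k => ∑ j, (a k j + a j k) * x j)
      (fun i j => a i j + a j i) x :=
  ⟨fun y k => ∑ j, (a k j + a j k) * y j, .of_forall fun _ => .quadratic a, rfl,
    fun _ => .linear _⟩

theorem add (hf : HasHess f c h x) (hg : HasHess g d k x) :
    HasHess (fun y => f y + g y) (fun i => c i + d i) (fun i j => h i j + k i j) x := by
  obtain ⟨F, h1, rfl, h2⟩ := hf
  obtain ⟨G, h3, rfl, h4⟩ := hg
  exact ⟨fun y i => F y i + G y i, (h1.and h3).mono fun y hy => hy.1.add hy.2, rfl,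
    fun j => (h2 j).add (h4 j)⟩

theorem mul (hf : HasHess f c h x) (hg : HasHess g d k x) :
    HasHess (fun y => f y * g y) (fun i => f x * d i + g x * c i)
      (fun j i => f x * k j i + g x * h j i + c i * d j + c j * d i) x := by
  have hf0 := hf.hasGrad
  have hg0 := hg.hasGrad
  obtain ⟨F, h1, rfl, h2⟩ := hf
  obtain ⟨G, h3, rfl, h4⟩ := hg
  exact ⟨fun y i => f y * G y i + g y * F y i, (h1.and h3).mono fun y hy => hy.1.mul hy.2, rfl,
    fun j => ((hf0.mul (h4 j)).add (hg0.mul (h2 j))).congr fun i => by ring⟩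

theorem const_mul (r : ℝ) (hf : HasHess f c h x) :
    HasHess (fun y => r * f y) (fun i => r * c i) (fun i j => r * h i j) x := by
  obtain ⟨F, h1, rfl, h2⟩ := hf
  exact ⟨fun y i => r * F y i, h1.mono fun y hy => hy.const_mul r, rfl,
    fun j => (h2 j).const_mul r⟩

theorem comp {F F' : ℝ → ℝ} {F'' : ℝ} (hF : ∀ᶠ t in nhds (f x), HasDerivAt F (F' t) t)
    (hF' : HasDerivAt F' F'' (f x)) (hf : HasHess f c h x) :
    HasHess (fun y => F (f y)) (fun i => F' (f x) * c i)
      (fun j i => F'' * c i * c j + F' (f x) * h j i) x := by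
  have hf0 := hf.hasGrad
  obtain ⟨G, h1, rfl, h2⟩ := hf
  refine ⟨fun y i => F' (f y) * G y i,
    (h1.and (hf0.continuousAt.eventually hF)).mono fun y hy => hy.1.comp hy.2, rfl,
    fun j => ((hf0.comp hF').mul (h2 j)).congr fun i => by ring⟩

end HasHess

theorem eventually_hasDerivAt {F : ℝ → ℝ} {t : ℝ} (hF : ContDiffAt ℝ ∞ F t) :
    ∀ᶠ r in nhds t, HasDerivAt F (deriv F r) r := by
  have h1 : ∀ᶠ r in nhds t, ContDiffAt ℝ 1 F r :=
    (hF.of_le (by simp)).eventually (by simp)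
  exact h1.mono fun r hr => (hr.differentiableAt (by simp)).hasDerivAt

theorem _root_.ContDiffAt.deriv_infty {F : ℝ → ℝ} {t : ℝ} (hF : ContDiffAt ℝ ∞ F t) :
    ContDiffAt ℝ ∞ (deriv F) t :=
  hF.derivWithin (by simp)

theorem _root_.ContDiffAt.hasDerivAt_deriv {F : ℝ → ℝ} {t : ℝ} (hF : ContDiffAt ℝ ∞ F t) :
    HasDerivAt F (deriv F t) t :=
  (hF.differentiableAt (by simp)).hasDerivAt

theorem HasHess.comp_contDiffAt {f : EuclideanSpace ℝ (Fin n) → ℝ} {c : Fin n → ℝ}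
    {h : Fin n → Fin n → ℝ} {x : EuclideanSpace ℝ (Fin n)} {F : ℝ → ℝ}
    (hF : ContDiffAt ℝ ∞ F (f x)) (hf : HasHess f c h x) :
    HasHess (fun y => F (f y)) (fun i => deriv F (f x) * c i)
      (fun j i => deriv (deriv F) (f x) * c i * c j + deriv F (f x) * h j i) x :=
  hf.comp (eventually_hasDerivAt hF) hF.deriv_infty.hasDerivAt_deriv

end Gradient

/-! ### The functions of `s` and the identities among them. -/

section ScalarFunctions

/-- `φ` is smooth at `s`, and satisfies there the regularity conditions of an `(α, β)`-metric. -/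
structure RegularAt (φ : ℝ → ℝ) (B s : ℝ) : Prop where
  smooth : ContDiffAt ℝ ∞ φ s
  pos : 0 < φ s
  regular : 0 < φ s - s * deriv φ s
  convex : 0 < φ s - s * deriv φ s + (B - s ^ 2) * deriv (deriv φ) s

/-- `Θ = (Q - s Q') / (2 Δ)`. -/
def Theta (φ : ℝ → ℝ) (B s : ℝ) : ℝ :=
  (Q φ s - s * deriv (Q φ) s) / (2 * Delta φ B s)

namespace RegularAt

variable {φ : ℝ → ℝ} {B s : ℝ} (h : RegularAt φ B s)

include h

theorem contDiffAt_Q : ContDiffAt ℝ ∞ (Q φ) s := by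
  have h1 := h.smooth
  have h2 := h.smooth.deriv_infty
  exact h2.div (h1.sub (contDiffAt_id.mul h2)) h.regular.ne'

theorem deriv_Q : deriv (Q φ) s = φ s * deriv (deriv φ) s / (φ s - s * deriv φ s) ^ 2 := by
  have h1 := h.smooth.hasDerivAt_deriv
  have h2 := h.smooth.deriv_infty.hasDerivAt_deriv
  have h3 := h2.fun_div (h1.fun_sub ((hasDerivAt_id' s).fun_mul h2)) h.regular.ne'
  refine (HasDerivAt.deriv h3).trans ?_
  congr 1
  ring

/-- This is where the three regularity conditions enter: every factor on the right is positive, so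
`Δ` can serve as a denominator. -/
theorem Delta_eq : Delta φ B s = φ s *
    (φ s - s * deriv φ s + (B - s ^ 2) * deriv (deriv φ) s) / (φ s - s * deriv φ s) ^ 2 := by
  have h1 := h.regular.ne'
  rw [Delta, h.deriv_Q, Q]
  field_simp
  ring

theorem Delta_pos : 0 < Delta φ B s := by
  rw [h.Delta_eq]
  exact div_pos (mul_pos h.pos h.convex) (pow_pos h.regular 2)

theorem Psi_eq : Psi φ B s = deriv (deriv φ) s /
    (2 * (φ s - s * deriv φ s + (B - s ^ 2) * deriv (deriv φ) s)) := by
  have h1 := h.regular.ne'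
  have h2 := h.convex.ne'
  have h3 := h.pos.ne'
  rw [Psi, h.Delta_eq, h.deriv_Q]
  field_simp

theorem Theta_eq : Theta φ B s =
    (deriv φ s * (φ s - s * deriv φ s) - s * (φ s * deriv (deriv φ) s)) /
      (2 * φ s * (φ s - s * deriv φ s + (B - s ^ 2) * deriv (deriv φ) s)) := by
  have h1 := h.regular.ne'
  have h2 := h.convex.ne'
  have h3 := h.pos.ne'
  rw [Theta, h.Delta_eq, h.deriv_Q, Q]
  generalize φ s - s * deriv φ s = W at *
  field_simp

theorem contDiffAt_Delta : ContDiffAt ℝ ∞ (Delta φ B) s := by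
  have h1 := h.contDiffAt_Q
  have h2 := h1.deriv_infty
  unfold Delta
  fun_prop

theorem contDiffAt_Psi : ContDiffAt ℝ ∞ (Psi φ B) s :=
  h.contDiffAt_Q.deriv_infty.div (contDiffAt_const.mul h.contDiffAt_Delta)
    (mul_pos two_pos h.Delta_pos).ne'

theorem contDiffAt_Theta : ContDiffAt ℝ ∞ (Theta φ B) s :=
  (h.contDiffAt_Q.sub (contDiffAt_id.mul h.contDiffAt_Q.deriv_infty)).div
    (contDiffAt_const.mul h.contDiffAt_Delta) (mul_pos two_pos h.Delta_pos).ne'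

theorem contDiffAt_Omega (n : ℕ) : ContDiffAt ℝ ∞ (Omega n φ B) s := by
  have h1 := h.contDiffAt_Q
  have h2 := h1.deriv_infty
  have h3 := h2.deriv_infty
  have h4 := h.contDiffAt_Delta
  have h5 : ContDiffAt ℝ ∞ (Phi n φ B) s := by
    unfold Phi
    fun_prop
  exact h5.div (contDiffAt_const.mul (h4.pow 2)) (mul_pos two_pos (pow_pos h.Delta_pos 2)).ne'

theorem deriv_Delta : deriv (Delta φ B) s =
    Q φ s - s * deriv (Q φ) s + (B - s ^ 2) * deriv (deriv (Q φ)) s := by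
  have h1 := h.contDiffAt_Q.hasDerivAt_deriv
  have h2 := h.contDiffAt_Q.deriv_infty.hasDerivAt_deriv
  have h3 := (((hasDerivAt_id' s).fun_mul h1).const_add 1).fun_add
    (((hasDerivAt_pow 2 s).const_sub B).fun_mul h2)
  refine (HasDerivAt.deriv h3).trans ?_
  push_cast
  ring

theorem deriv_Psi : deriv (Psi φ B) s =
    (deriv (deriv (Q φ)) s * Delta φ B s - deriv (Q φ) s * deriv (Delta φ B) s) /
      (2 * Delta φ B s ^ 2) := by
  have h1 := h.Delta_pos.ne'
  have h2 := h.contDiffAt_Q.deriv_infty.hasDerivAt_deriv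
  have h3 := h2.fun_div (h.contDiffAt_Delta.hasDerivAt_deriv.const_mul 2)
    (mul_pos two_pos h.Delta_pos).ne'
  refine (HasDerivAt.deriv h3).trans ?_
  field_simp

/-- This combination is the factor of `(r₀₀ - 2αQ s₀) / α` in the divergence. The term `(n + 1)Θ`
comes from the `y`-direction, by homogeneity, and `(b² - s²)Ψ'` from the derivative of `s` along
`b^i`. -/
theorem Theta_add_deriv_Psi (n : ℕ) :
    (n + 1) * Theta φ B s + (B - s ^ 2) * deriv (Psi φ B) s = -Omega n φ B s := by
  have h1 := h.Delta_pos.ne'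
  rw [h.deriv_Psi, h.deriv_Delta, Omega, Phi, Theta]
  have h2 : Delta φ B s = 1 + s * Q φ s + (B - s ^ 2) * deriv (Q φ) s := rfl
  generalize deriv (deriv (Q φ)) s = q2 at *
  generalize deriv (Q φ) s = q1 at *
  generalize Q φ s = q at *
  generalize Delta φ B s = D at *
  -- Eliminating `1 + sQ` in favour of `Δ` leaves `Δ` as an independent symbol and the only
  -- denominator.
  have h3 : 1 + s * q = D - (B - s ^ 2) * q1 := by rw [h2]; ring
  rw [show n * D + 1 + s * q = n * D + (1 + s * q) by ring, h3]
  field_simp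
  ring

/-- `Δ` is left expanded because `sQ + (b² - s²)Q'` arises as the derivative of `αQ` along `b^i`. -/
theorem Psi_mul_Delta : 2 * Psi φ B s *
    (1 + s * Q φ s + (B - s ^ 2) * deriv (Q φ) s) = deriv (Q φ) s := by
  have h1 := h.Delta_pos.ne'
  change 2 * Psi φ B s * Delta φ B s = _
  rw [Psi]
  field_simp

end RegularAt

end ScalarFunctions

/-! ### The fundamental tensor of `α φ(β / α)`. -/

section Metric

variable {n : ℕ}

/-- The quadratic form `a_ij y^i y^j`. -/
def quad (a : Matrix (Fin n) (Fin n) ℝ) (y : EuclideanSpace ℝ (Fin n)) : ℝ :=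
  ∑ i, ∑ j, a i j * y i * y j

/-- `s = β / α`. -/
def slope (a : Matrix (Fin n) (Fin n) ℝ) (b : Fin n → ℝ) (y : EuclideanSpace ℝ (Fin n)) : ℝ :=
  (∑ i, b i * y i) / Real.sqrt (quad a y)

/-- The Finsler function `α φ(β / α)` in coordinates. -/
def abMetric (φ : ℝ → ℝ) (a : EuclideanSpace ℝ (Fin n) → Matrix (Fin n) (Fin n) ℝ)
    (b : EuclideanSpace ℝ (Fin n) → Fin n → ℝ) (u y : EuclideanSpace ℝ (Fin n)) : ℝ :=
  Real.sqrt (quad (a u) y) * φ (slope (a u) (b u) y)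

/-- `φ (φ - s φ')`, the derivative of `α² φ(β/α)²` in `α²`. -/
def wA (φ : ℝ → ℝ) (s : ℝ) : ℝ := φ s * (φ s - s * deriv φ s)

/-- `φ φ'`; the derivative of `α² φ(β/α)²` in `β` is `2 α φ φ'`. -/
def wB (φ : ℝ → ℝ) (s : ℝ) : ℝ := φ s * deriv φ s

/-- The derivative `φ'² + φ φ''` of `φ φ'`. -/
def wB' (φ : ℝ → ℝ) (s : ℝ) : ℝ := deriv φ s ^ 2 + φ s * deriv (deriv φ) s

/-- The derivative of `φ (φ - s φ')`. -/
def wA' (φ : ℝ → ℝ) (s : ℝ) : ℝ := wB φ s - s * wB' φ s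

theorem hasDerivAt_wA {φ : ℝ → ℝ} {s : ℝ} (h : ContDiffAt ℝ ∞ φ s) :
    HasDerivAt (wA φ) (wA' φ s) s := by
  have h1 := h.hasDerivAt_deriv
  have h2 := h.deriv_infty.hasDerivAt_deriv
  refine (h1.fun_mul (h1.fun_sub ((hasDerivAt_id' s).fun_mul h2))).congr_deriv ?_
  simp only [wA', wB, wB']
  ring

theorem hasDerivAt_wB {φ : ℝ → ℝ} {s : ℝ} (h : ContDiffAt ℝ ∞ φ s) :
    HasDerivAt (wB φ) (wB' φ s) s := by
  refine (h.hasDerivAt_deriv.fun_mul h.deriv_infty.hasDerivAt_deriv).congr_deriv ?_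
  simp only [wB']
  ring

section

variable {φ : ℝ → ℝ} {A β : EuclideanSpace ℝ (Fin n) → ℝ} {cA cβ : Fin n → ℝ}
  {x : EuclideanSpace ℝ (Fin n)}

theorem HasGrad.div_sqrt (hA : HasGrad A cA x) (hβ : HasGrad β cβ x) (h0 : 0 < A x) :
    HasGrad (fun x => β x / Real.sqrt (A x))
      (fun i => (cβ i - β x / Real.sqrt (A x) * (cA i / (2 * Real.sqrt (A x)))) /
        Real.sqrt (A x)) x :=
  hβ.div (hA.sqrt h0) (Real.sqrt_pos.2 h0).ne'

/-- `A = α²` and `β` are arbitrary functions of one variable point, so the same formula serves for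
derivatives in `y` and in `x`. -/
theorem HasGrad.sq_metric (hA : HasGrad A cA x) (hβ : HasGrad β cβ x) (h0 : 0 < A x)
    (hφ : ContDiffAt ℝ ∞ φ (β x / Real.sqrt (A x))) :
    HasGrad (fun x => (Real.sqrt (A x) * φ (β x / Real.sqrt (A x))) ^ 2)
      (fun i => wA φ (β x / Real.sqrt (A x)) * cA i +
        2 * (Real.sqrt (A x) * wB φ (β x / Real.sqrt (A x)) * cβ i)) x := by
  have h1 := (hA.sqrt h0).mul (comp hφ.hasDerivAt_deriv (hA.div_sqrt hβ h0))
  simp only [pow_two]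
  refine (h1.mul h1).congr fun i => ?_
  have h2 : Real.sqrt (A x) ≠ 0 := (Real.sqrt_pos.2 h0).ne'
  simp only [wA, wB]
  generalize deriv φ (β x / √(A x)) = φ1
  generalize φ (β x / √(A x)) = φ0
  field_simp
  ring

/-- The function differentiated is `∂F²/∂y^l`, with `l` and `c` standing for `y_l` and `b_l`.
Differentiating in `y` yields the fundamental tensor, in `x` the mixed derivatives of the spray. -/
theorem HasGrad.momentum {l c : EuclideanSpace ℝ (Fin n) → ℝ} {cl cc : Fin n → ℝ}
    (hA : HasGrad A cA x) (hβ : HasGrad β cβ x) (h0 : 0 < A x)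
    (hφ : ContDiffAt ℝ ∞ φ (β x / Real.sqrt (A x))) (hl : HasGrad l cl x) (hc : HasGrad c cc x) :
    HasGrad (fun x => wA φ (β x / Real.sqrt (A x)) * (2 * l x) +
        2 * (Real.sqrt (A x) * wB φ (β x / Real.sqrt (A x)) * c x))
      (fun i => 2 * (wA φ (β x / Real.sqrt (A x)) * cl i + l x * (wA' φ (β x / Real.sqrt (A x)) *
          ((cβ i - β x / Real.sqrt (A x) * (cA i / (2 * Real.sqrt (A x)))) / Real.sqrt (A x)))) +
        2 * (Real.sqrt (A x) * wB φ (β x / Real.sqrt (A x)) * cc i +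
          c x * (wB' φ (β x / Real.sqrt (A x)) *
              (cβ i - β x / Real.sqrt (A x) * (cA i / (2 * Real.sqrt (A x)))) +
            wB φ (β x / Real.sqrt (A x)) * (cA i / (2 * Real.sqrt (A x)))))) x := by
  have hs := hA.div_sqrt hβ h0
  have h1 := (comp (hasDerivAt_wA hφ) hs).mul (hl.const_mul 2)
  have h2 := (((hA.sqrt h0).mul (comp (hasDerivAt_wB hφ) hs)).mul hc).const_mul 2
  refine (h1.add h2).congr fun i => ?_
  have h3 : Real.sqrt (A x) ≠ 0 := (Real.sqrt_pos.2 h0).ne'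
  field_simp

end

theorem hasGrad_quad {a : Matrix (Fin n) (Fin n) ℝ} (ha : a.IsSymm)
    (y : EuclideanSpace ℝ (Fin n)) : HasGrad (quad a) (fun i => 2 * (a *ᵥ y.ofLp) i) y := by
  refine (HasGrad.quadratic a).congr fun i => ?_
  rw [Matrix.mulVec, dotProduct, Finset.mul_sum]
  refine Finset.sum_congr rfl fun j _ => ?_
  rw [ha.apply i j]
  ring

theorem hasGrad_slope {a : Matrix (Fin n) (Fin n) ℝ} (ha : a.IsSymm) (b : Fin n → ℝ)
    {y : EuclideanSpace ℝ (Fin n)} (hy : 0 < quad a y) :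
    HasGrad (slope a b) (fun i => (b i - slope a b y * ((a *ᵥ y.ofLp) i / Real.sqrt (quad a y))) /
      Real.sqrt (quad a y)) y := by
  refine ((hasGrad_quad ha y).div_sqrt (HasGrad.linear b) hy).congr fun i => ?_
  rw [mul_div_mul_left _ _ two_ne_zero]
  rfl

section

variable {φ : ℝ → ℝ} {J : Set ℝ} {a : EuclideanSpace ℝ (Fin n) → Matrix (Fin n) (Fin n) ℝ}
  {b : EuclideanSpace ℝ (Fin n) → Fin n → ℝ} {u y : EuclideanSpace ℝ (Fin n)}

theorem hasGrad_sq_abMetric (ha : (a u).IsSymm) (hy : 0 < quad (a u) y)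
    (hφ : ContDiffAt ℝ ∞ φ (slope (a u) (b u) y)) :
    HasGrad (fun y' => abMetric φ a b u y' ^ 2)
      (fun i => wA φ (slope (a u) (b u) y) * (2 * (a u *ᵥ y.ofLp) i) +
        2 * (Real.sqrt (quad (a u) y) * wB φ (slope (a u) (b u) y) * b u i)) y :=
  (hasGrad_quad ha y).sq_metric (HasGrad.linear (b u)) hy hφ

theorem eventually_mem_domain (hJ : IsOpen J) {a : Matrix (Fin n) (Fin n) ℝ} (ha : a.IsSymm)
    {b : Fin n → ℝ} (hy : 0 < quad a y) (hs : slope a b y ∈ J) :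
    ∀ᶠ y' in nhds y, 0 < quad a y' ∧ slope a b y' ∈ J :=
  ((hasGrad_quad ha y).continuousAt.eventually (lt_mem_nhds hy)).and
    ((hasGrad_slope ha b hy).continuousAt.eventually (hJ.mem_nhds hs))

/-- The classical shape `ρ a_ij + ρ₀ b_i b_j + ρ₁ (b_i α_j + b_j α_i) - s ρ₁ α_i α_j` with `α_i =
y_i / α`, where `ρ`, `ρ₀`, `ρ₁` are `wA`, `wB'`, `wA'`. -/
theorem fundamentalTensor_abMetric (hJ : IsOpen J) (hφ : ContDiffOn ℝ ∞ φ J) (ha : (a u).IsSymm)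
    (hy : 0 < quad (a u) y) (hs : slope (a u) (b u) y ∈ J) (i j : Fin n) :
    fundamentalTensor (abMetric φ a b) u y i j =
      wA φ (slope (a u) (b u) y) * a u i j +
      wA' φ (slope (a u) (b u) y) / Real.sqrt (quad (a u) y) *
        ((a u *ᵥ y.ofLp) i * b u j + b u i * (a u *ᵥ y.ofLp) j) -
      slope (a u) (b u) y * wA' φ (slope (a u) (b u) y) / Real.sqrt (quad (a u) y) ^ 2 *
        ((a u *ᵥ y.ofLp) i * (a u *ᵥ y.ofLp) j) +
      wB' φ (slope (a u) (b u) y) * (b u i * b u j) := by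
  have h1 := HasGrad.momentum (hasGrad_quad ha y) (HasGrad.linear (b u)) hy
    (hφ.contDiffAt (hJ.mem_nhds hs)) (HasGrad.linear fun i => a u j i) (HasGrad.const (b u j))
  have h2 : (fun y' => pd j (fun y'' => abMetric φ a b u y'' ^ 2) y') =ᶠ[nhds y] _ :=
    (eventually_mem_domain hJ ha hy hs).mono fun y' hy' =>
      (hasGrad_sq_abMetric ha hy'.1 (hφ.contDiffAt (hJ.mem_nhds hy'.2))).pd_eq j
  rw [fundamentalTensor, Matrix.of_apply, pd_congr h2]
  refine (congrArg _ (h1.pd_eq i)).trans ?_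
  have h3 : Real.sqrt (quad (a u) y) ≠ 0 := (Real.sqrt_pos.2 hy).ne'
  change 1 / 2 * (2 * (wA φ (slope (a u) (b u) y) * a u j i + (a u *ᵥ y.ofLp) j *
      (wA' φ (slope (a u) (b u) y) * ((b u i - slope (a u) (b u) y * (2 * (a u *ᵥ y.ofLp) i /
        (2 * √(quad (a u) y)))) / √(quad (a u) y)))) +
    2 * (√(quad (a u) y) * wB φ (slope (a u) (b u) y) * 0 + b u j * (wB' φ (slope (a u) (b u) y) *
      (b u i - slope (a u) (b u) y * (2 * (a u *ᵥ y.ofLp) i / (2 * √(quad (a u) y)))) +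
        wB φ (slope (a u) (b u) y) * (2 * (a u *ᵥ y.ofLp) i / (2 * √(quad (a u) y)))))) = _
  have h4 : wB φ (slope (a u) (b u) y) = wA' φ (slope (a u) (b u) y) +
    slope (a u) (b u) y * wB' φ (slope (a u) (b u) y) := by rw [wA']; ring
  rw [h4, ha.apply i j]
  field_simp
  ring

theorem fundamentalTensor_mulVec (hJ : IsOpen J) (hφ : ContDiffOn ℝ ∞ φ J) (ha : (a u).IsSymm)
    (hy : 0 < quad (a u) y) (hs : slope (a u) (b u) y ∈ J) (v : Fin n → ℝ) (i : Fin n) :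
    (fundamentalTensor (abMetric φ a b) u y *ᵥ v) i =
      wA φ (slope (a u) (b u) y) * (a u *ᵥ v) i +
      (wA' φ (slope (a u) (b u) y) / Real.sqrt (quad (a u) y) * (b u ⬝ᵥ v) -
        slope (a u) (b u) y * wA' φ (slope (a u) (b u) y) / Real.sqrt (quad (a u) y) ^ 2 *
          ((a u *ᵥ y.ofLp) ⬝ᵥ v)) * (a u *ᵥ y.ofLp) i +
      (wA' φ (slope (a u) (b u) y) / Real.sqrt (quad (a u) y) * ((a u *ᵥ y.ofLp) ⬝ᵥ v) +
        wB' φ (slope (a u) (b u) y) * (b u ⬝ᵥ v)) * b u i := by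
  have h1 : (fundamentalTensor (abMetric φ a b) u y *ᵥ v) i =
    ∑ j, fundamentalTensor (abMetric φ a b) u y i j * v j := rfl
  have h2 : (a u *ᵥ v) i = ∑ j, a u i j * v j := rfl
  simp only [h1, h2, fundamentalTensor_abMetric hJ hφ ha hy hs]
  generalize a u *ᵥ y.ofLp = w
  rw [dotProduct, dotProduct]
  simp only [Finset.mul_sum, Finset.sum_mul, ← Finset.sum_add_distrib, ← Finset.sum_sub_distrib]
  exact Finset.sum_congr rfl fun j _ => by ring

end

end Metric

/-! ### The spray of `α` and the tensors `r_ij`, `s_ij`. -/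

section Tensors

variable {n : ℕ} {a : EuclideanSpace ℝ (Fin n) → Matrix (Fin n) (Fin n) ℝ}
  {b : EuclideanSpace ℝ (Fin n) → Fin n → ℝ} {u : EuclideanSpace ℝ (Fin n)}

theorem mulVec_dotProduct {A : Matrix (Fin n) (Fin n) ℝ} (hA : A.IsSymm) (v w : Fin n → ℝ) :
    (A *ᵥ v) ⬝ᵥ w = v ⬝ᵥ (A *ᵥ w) := by
  rw [Matrix.dotProduct_mulVec, ← Matrix.mulVec_transpose, hA.eq]

theorem mulVec_inv_mulVec {A : Matrix (Fin n) (Fin n) ℝ} (hA : IsUnit A.det) (v : Fin n → ℝ) :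
    A *ᵥ (A⁻¹ *ᵥ v) = v := by
  rw [Matrix.mulVec_mulVec, Matrix.mul_nonsing_inv _ hA, Matrix.one_mulVec]

theorem isUnit_det_of_injective {A : Matrix (Fin n) (Fin n) ℝ}
    (h : ∀ v : Fin n → ℝ, A *ᵥ v = 0 → v = 0) : IsUnit A.det := by
  rw [isUnit_iff_ne_zero]
  intro h0
  obtain ⟨v, hv, hv0⟩ := Matrix.exists_mulVec_eq_zero_iff.2 h0
  exact hv (h v hv0)

theorem dotProduct_mulVec_eq_quad (A : Matrix (Fin n) (Fin n) ℝ)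
    (y : EuclideanSpace ℝ (Fin n)) : y.ofLp ⬝ᵥ (A *ᵥ y.ofLp) = quad A y := by
  simp only [dotProduct, Matrix.mulVec, quad, Finset.mul_sum]
  exact Finset.sum_congr rfl fun i _ => Finset.sum_congr rfl fun j _ => by ring

theorem isUnit_det_of_quad_pos {A : Matrix (Fin n) (Fin n) ℝ} (h : ∀ y, y ≠ 0 → 0 < quad A y) :
    IsUnit A.det := by
  refine isUnit_det_of_injective fun v hv => ?_
  by_contra h0
  have h1 := h (WithLp.toLp 2 v) (by simpa using h0)
  rw [← dotProduct_mulVec_eq_quad] at h1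
  simp [hv] at h1

theorem pd_comm_of_symm (ha : ∀ u', (a u').IsSymm) (k i j : Fin n) :
    pd k (fun u' => a u' i j) u = pd k (fun u' => a u' j i) u :=
  congrArg (fun f => pd k f u) (funext fun u' => (ha u').apply j i)

theorem christoffel_symm (ha : ∀ u', (a u').IsSymm) (k i j : Fin n) :
    christoffel a u k i j = christoffel a u k j i := by
  unfold christoffel
  congr 1
  refine Finset.sum_congr rfl fun l _ => ?_
  rw [pd_comm_of_symm ha l i j]
  ring

/-- The spray coefficients `(1/2) Γ^i_jk y^j y^k` of the Riemannian metric. -/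
def geodesicCoeff (a : EuclideanSpace ℝ (Fin n) → Matrix (Fin n) (Fin n) ℝ)
    (u y : EuclideanSpace ℝ (Fin n)) (i : Fin n) : ℝ :=
  1 / 2 * ∑ j, ∑ k, christoffel a u i j k * y j * y k

variable (y : EuclideanSpace ℝ (Fin n))

/-- Lowering the index cancels the inverse matrix in the Christoffel symbols, and two of their three
terms agree after contraction with `y`. -/
theorem mulVec_geodesicCoeff (hu : IsUnit (a u).det) (l : Fin n) :
    4 * (a u *ᵥ geodesicCoeff a u y) l =
      2 * ∑ k, (∑ j, pd k (fun u' => a u' l j) u * y j) * y k -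
        ∑ i, ∑ j, pd l (fun u' => a u' i j) u * y i * y j := by
  have h1 : geodesicCoeff a u y = (a u)⁻¹ *ᵥ fun l => 1 / 4 * ∑ j, ∑ k,
      (pd k (fun u' => a u' l j) u + pd j (fun u' => a u' l k) u - pd l (fun u' => a u' j k) u) *
        y j * y k := by
    ext i
    simp only [geodesicCoeff, christoffel, Matrix.mulVec, dotProduct, Finset.mul_sum,
      Finset.sum_mul]
    rw [Finset.sum_comm' (t' := Finset.univ) (s' := fun _ => Finset.univ) (by simp)]
    conv_rhs => rw [Finset.sum_comm]
    rw [Finset.sum_comm]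
    refine Finset.sum_congr rfl fun j _ => ?_
    conv_rhs => rw [Finset.sum_comm]
    refine Finset.sum_congr rfl fun k _ => Finset.sum_congr rfl fun l _ => ?_
    ring
  rw [h1, mulVec_inv_mulVec hu]
  have h2 : ∑ j, ∑ k, pd j (fun u' => a u' l k) u * y j * y k =
      ∑ k, (∑ j, pd k (fun u' => a u' l j) u * y j) * y k := by
    simp only [Finset.sum_mul]
    exact Finset.sum_congr rfl fun j _ => Finset.sum_congr rfl fun k _ => by ring
  have h3 : ∑ j, ∑ k, pd k (fun u' => a u' l j) u * y j * y k =
      ∑ k, (∑ j, pd k (fun u' => a u' l j) u * y j) * y k := by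
    rw [Finset.sum_comm]
    simp only [Finset.sum_mul]
  simp only [add_mul, sub_mul, Finset.sum_add_distrib, Finset.sum_sub_distrib, h2, h3]
  ring

theorem dotProduct_geodesicCoeff (ha : ∀ u', (a u').IsSymm) (hu : IsUnit (a u).det) :
    4 * ((a u *ᵥ y.ofLp) ⬝ᵥ geodesicCoeff a u y) =
      ∑ k, (∑ i, ∑ j, pd k (fun u' => a u' i j) u * y i * y j) * y k := by
  rw [mulVec_dotProduct (ha u), dotProduct, Finset.mul_sum]
  have h1 : ∀ l, 4 * (y.ofLp l * (a u *ᵥ geodesicCoeff a u y) l) =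
      2 * (∑ k, (∑ j, pd k (fun u' => a u' l j) u * y j) * y k * y l) -
        (∑ i, ∑ j, pd l (fun u' => a u' i j) u * y i * y j) * y l := fun l => by
    rw [mul_left_comm, mulVec_geodesicCoeff y hu, ← Finset.sum_mul]
    ring
  simp only [h1, Finset.sum_sub_distrib, ← Finset.mul_sum]
  have h2 : ∑ l, ∑ k, (∑ j, pd k (fun u' => a u' l j) u * y j) * y k * y l =
      ∑ k, (∑ i, ∑ j, pd k (fun u' => a u' i j) u * y i * y j) * y k := by
    rw [Finset.sum_comm]
    simp only [Finset.sum_mul]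
    exact Finset.sum_congr rfl fun k _ => Finset.sum_congr rfl fun i _ =>
      Finset.sum_congr rfl fun j _ => by ring
  rw [h2]
  ring

/-- Contraction with `y` twice sees only the symmetric part of `b_{i|j}`, and its Christoffel term
is twice the spray of `α` paired with `β`. -/
theorem rTensor_quadratic :
    ∑ i, ∑ j, rTensor a b u i j * y i * y j =
      ∑ k, (∑ i, pd k (fun u' => b u' i) u * y i) * y k - 2 * (b u ⬝ᵥ geodesicCoeff a u y) := by
  have h1 : ∑ i, ∑ j, rTensor a b u i j * y i * y j = ∑ i, ∑ j, covDeriv a b u i j * y i * y j := by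
    have h2 : ∑ i, ∑ j, covDeriv a b u j i * y i * y j =
        ∑ i, ∑ j, covDeriv a b u i j * y i * y j := by
      rw [Finset.sum_comm]
      exact Finset.sum_congr rfl fun i _ => Finset.sum_congr rfl fun j _ => by ring
    have h3 : ∀ i j, rTensor a b u i j * y i * y j = 1 / 2 * (covDeriv a b u i j * y i * y j) +
      1 / 2 * (covDeriv a b u j i * y i * y j) := fun i j => by rw [rTensor]; ring
    simp only [h3, Finset.sum_add_distrib, ← Finset.mul_sum, h2]
    ring
  have h2 : 2 * (b u ⬝ᵥ geodesicCoeff a u y) =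
      ∑ i, ∑ j, (∑ k, christoffel a u k i j * b u k) * y i * y j := by
    simp only [dotProduct, geodesicCoeff, Finset.mul_sum, Finset.sum_mul]
    rw [Finset.sum_comm]
    refine Finset.sum_congr rfl fun i _ => ?_
    rw [Finset.sum_comm]
    exact Finset.sum_congr rfl fun j _ => Finset.sum_congr rfl fun k _ => by ring
  have h3 : ∑ k, (∑ i, pd k (fun u' => b u' i) u * y i) * y k =
      ∑ i, ∑ j, pd j (fun u' => b u' i) u * y i * y j := by
    rw [Finset.sum_comm]
    simp only [Finset.sum_mul]
  rw [h1, h2, h3, ← Finset.sum_sub_distrib]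
  refine Finset.sum_congr rfl fun i _ => ?_
  rw [← Finset.sum_sub_distrib]
  refine Finset.sum_congr rfl fun j _ => ?_
  rw [covDeriv]
  ring

/-- The Christoffel terms cancel by symmetry in the lower indices. -/
theorem sTensor_apply (ha : ∀ u', (a u').IsSymm) (l : Fin n) :
    2 * (Matrix.of (sTensor a b u) *ᵥ y.ofLp) l =
      ∑ k, pd k (fun u' => b u' l) u * y k - ∑ i, pd l (fun u' => b u' i) u * y i := by
  simp only [Matrix.mulVec, dotProduct, Matrix.of_apply, Finset.mul_sum, ← Finset.sum_sub_distrib]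
  refine Finset.sum_congr rfl fun k _ => ?_
  have h1 : ∑ m, christoffel a u m l k * b u m = ∑ m, christoffel a u m k l * b u m :=
    Finset.sum_congr rfl fun m _ => by rw [christoffel_symm ha]
  rw [sTensor, covDeriv, covDeriv, h1]
  ring

theorem sTensor_antisymm (i j : Fin n) : sTensor a b u i j = -sTensor a b u j i := by
  rw [sTensor, sTensor]
  ring

theorem dotProduct_antisymm {S : Matrix (Fin n) (Fin n) ℝ} (hS : ∀ i j, S i j = -S j i)
    (v : Fin n → ℝ) : v ⬝ᵥ (S *ᵥ v) = 0 := by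
  have h1 : Sᵀ = -S := by
    ext i j
    simp [hS j i]
  have h2 : v ⬝ᵥ (S *ᵥ v) = -(v ⬝ᵥ (S *ᵥ v)) := by
    conv_lhs => rw [Matrix.dotProduct_mulVec, ← Matrix.mulVec_transpose, h1, Matrix.neg_mulVec,
      neg_dotProduct, dotProduct_comm]
  linarith

theorem mulVec_bUp (hu : IsUnit (a u).det) : a u *ᵥ bUp a b u = b u :=
  mulVec_inv_mulVec hu _

theorem dotProduct_bUp : b u ⬝ᵥ bUp a b u = normSq a b u := by
  rw [dotProduct_comm]
  rfl

theorem sForm_dotProduct :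
    ∑ j, sForm a b u j * y j = bUp a b u ⬝ᵥ (Matrix.of (sTensor a b u) *ᵥ y.ofLp) := by
  rw [Matrix.dotProduct_mulVec]
  rfl

end Tensors

/-! ### The spray coefficients of `α φ(β / α)`. -/

section Spray

variable {n : ℕ} {φ : ℝ → ℝ} {J : Set ℝ}
  {a : EuclideanSpace ℝ (Fin n) → Matrix (Fin n) (Fin n) ℝ}
  {b : EuclideanSpace ℝ (Fin n) → Fin n → ℝ} {u y : EuclideanSpace ℝ (Fin n)}

theorem hasGrad_quad_left (ha : ∀ i j, DifferentiableAt ℝ (fun u' => a u' i j) u) :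
    HasGrad (fun u' => quad (a u') y)
      (fun l => ∑ i, ∑ j, pd l (fun u' => a u' i j) u * y i * y j) u :=
  .sum fun i _ => .sum fun j _ => ((ha i j).hasGrad.mul_const _).mul_const _

theorem hasGrad_form_left (hb : ∀ i, DifferentiableAt ℝ (fun u' => b u' i) u) :
    HasGrad (fun u' => ∑ i, b u' i * y i) (fun l => ∑ i, pd l (fun u' => b u' i) u * y i) u :=
  .sum fun i _ => (hb i).hasGrad.mul_const _

theorem eventually_mem_domain_left (hJ : IsOpen J)
    (ha : ∀ i j, DifferentiableAt ℝ (fun u' => a u' i j) u)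
    (hb : ∀ i, DifferentiableAt ℝ (fun u' => b u' i) u)
    (hy : 0 < quad (a u) y) (hs : slope (a u) (b u) y ∈ J) :
    ∀ᶠ u' in nhds u, 0 < quad (a u') y ∧ slope (a u') (b u') y ∈ J :=
  ((hasGrad_quad_left ha).continuousAt.eventually (lt_mem_nhds hy)).and
    (((hasGrad_quad_left ha).div_sqrt (hasGrad_form_left hb) hy).continuousAt.eventually
      (hJ.mem_nhds hs))

theorem pd_left_sq_abMetric (hJ : IsOpen J) (hφ : ContDiffOn ℝ ∞ φ J)
    (ha : ∀ i j, DifferentiableAt ℝ (fun u' => a u' i j) u)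
    (hb : ∀ i, DifferentiableAt ℝ (fun u' => b u' i) u)
    (hy : 0 < quad (a u) y) (hs : slope (a u) (b u) y ∈ J) (l : Fin n) :
    pd l (fun u' => abMetric φ a b u' y ^ 2) u =
      wA φ (slope (a u) (b u) y) * (∑ i, ∑ j, pd l (fun u' => a u' i j) u * y i * y j) +
        2 * (Real.sqrt (quad (a u) y) * wB φ (slope (a u) (b u) y) *
          ∑ i, pd l (fun u' => b u' i) u * y i) :=
  ((hasGrad_quad_left ha).sq_metric (hasGrad_form_left hb) hy
    (hφ.contDiffAt (hJ.mem_nhds hs))).pd_eq l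

theorem sum_pd_left_pd_sq_abMetric (hJ : IsOpen J) (hφ : ContDiffOn ℝ ∞ φ J)
    (hsymm : ∀ u', (a u').IsSymm)
    (ha : ∀ i j, DifferentiableAt ℝ (fun u' => a u' i j) u)
    (hb : ∀ i, DifferentiableAt ℝ (fun u' => b u' i) u)
    (hy : 0 < quad (a u) y) (hs : slope (a u) (b u) y ∈ J) (l : Fin n) :
    ∑ k, pd k (fun u' => pd l (fun y' => abMetric φ a b u' y' ^ 2) y) u * y k =
      2 * (wA φ (slope (a u) (b u) y) * (∑ k, (∑ j, pd k (fun u' => a u' l j) u * y j) * y k) +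
        (a u *ᵥ y.ofLp) l * (wA' φ (slope (a u) (b u) y) *
          (((∑ k, (∑ i, pd k (fun u' => b u' i) u * y i) * y k) - slope (a u) (b u) y *
            ((∑ k, (∑ i, ∑ j, pd k (fun u' => a u' i j) u * y i * y j) * y k) /
              (2 * Real.sqrt (quad (a u) y)))) / Real.sqrt (quad (a u) y)))) +
      2 * (Real.sqrt (quad (a u) y) * wB φ (slope (a u) (b u) y) *
          (∑ k, pd k (fun u' => b u' l) u * y k) +
        b u l * (wB' φ (slope (a u) (b u) y) *
          ((∑ k, (∑ i, pd k (fun u' => b u' i) u * y i) * y k) - slope (a u) (b u) y *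
            ((∑ k, (∑ i, ∑ j, pd k (fun u' => a u' i j) u * y i * y j) * y k) /
              (2 * Real.sqrt (quad (a u) y)))) +
          wB φ (slope (a u) (b u) y) *
            ((∑ k, (∑ i, ∑ j, pd k (fun u' => a u' i j) u * y i * y j) * y k) /
              (2 * Real.sqrt (quad (a u) y))))) := by
  have hl : HasGrad (fun u' => (a u' *ᵥ y.ofLp) l)
      (fun k => ∑ j, pd k (fun u' => a u' l j) u * y j) u :=
    HasGrad.sum (s := Finset.univ) (f := fun j u' => a u' l j * y j)
      fun j _ => (ha l j).hasGrad.mul_const (y j)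
  have h1 := HasGrad.momentum (hasGrad_quad_left ha) (hasGrad_form_left hb) hy
    (hφ.contDiffAt (hJ.mem_nhds hs)) hl (hb l).hasGrad
  have h2 : (fun u' => pd l (fun y' => abMetric φ a b u' y' ^ 2) y) =ᶠ[nhds u] _ :=
    (eventually_mem_domain_left hJ ha hb hy hs).mono fun u' hu' =>
      (hasGrad_sq_abMetric (hsymm u') hu'.1 (hφ.contDiffAt (hJ.mem_nhds hu'.2))).pd_eq l
  have h3 : ∀ k, pd k (fun u' => pd l (fun y' => abMetric φ a b u' y' ^ 2) y) u = _ := fun k =>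
    (pd_congr h2 k).trans (h1.pd_eq k)
  simp only [h3]
  -- The quotients `β / α` from the general lemma are refolded into `slope`, so that they can be
  -- abstracted next.
  change ∑ k, (2 * (wA φ (slope (a u) (b u) y) * _ + _ * (wA' φ (slope (a u) (b u) y) *
    ((_ - slope (a u) (b u) y * _) / _))) + 2 * (_ * wB φ (slope (a u) (b u) y) * _ +
    _ * (wB' φ (slope (a u) (b u) y) * (_ - slope (a u) (b u) y * _) +
      wB φ (slope (a u) (b u) y) * _))) * _ = _
  generalize slope (a u) (b u) y = s
  generalize √(quad (a u) y) = α
  generalize (a u *ᵥ y.ofLp) l = w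
  -- The four gradients enter linearly, so the contraction with `y^k` passes inside.
  have h4 : ∀ p q r t : Fin n → ℝ, ∑ k, (2 * (wA φ s * r k + w * (wA' φ s *
      ((q k - s * (p k / (2 * α))) / α))) + 2 * (α * wB φ s * t k + b u l * (wB' φ s *
        (q k - s * (p k / (2 * α))) + wB φ s * (p k / (2 * α))))) * y k =
      2 * (wA φ s * (∑ k, r k * y k) + w * (wA' φ s *
        (((∑ k, q k * y k) - s * ((∑ k, p k * y k) / (2 * α))) / α))) +
      2 * (α * wB φ s * (∑ k, t k * y k) + b u l * (wB' φ s *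
        ((∑ k, q k * y k) - s * ((∑ k, p k * y k) / (2 * α))) +
          wB φ s * ((∑ k, p k * y k) / (2 * α)))) := by
    intro p q r t
    simp only [Finset.mul_sum, Finset.sum_div, ← Finset.sum_add_distrib, ← Finset.sum_sub_distrib]
    exact Finset.sum_congr rfl fun k _ => by ring
  exact h4 _ _ _ _

/-- The difference of the spray coefficients of `α φ(β / α)` and `α`. -/
def sprayDiff (φ : ℝ → ℝ) (a : EuclideanSpace ℝ (Fin n) → Matrix (Fin n) (Fin n) ℝ)
    (b : EuclideanSpace ℝ (Fin n) → Fin n → ℝ) (u y : EuclideanSpace ℝ (Fin n)) : Fin n → ℝ :=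
  (Real.sqrt (quad (a u) y) * Q φ (slope (a u) (b u) y)) •
      ((a u)⁻¹ *ᵥ (Matrix.of (sTensor a b u) *ᵥ y.ofLp)) +
    (Theta φ (normSq a b u) (slope (a u) (b u) y) *
      ((∑ i, ∑ j, rTensor a b u i j * y i * y j) - 2 * Real.sqrt (quad (a u) y) *
        Q φ (slope (a u) (b u) y) * ∑ j, sForm a b u j * y j) / Real.sqrt (quad (a u) y)) •
      y.ofLp +
    (Psi φ (normSq a b u) (slope (a u) (b u) y) *
      ((∑ i, ∑ j, rTensor a b u i j * y i * y j) - 2 * Real.sqrt (quad (a u) y) *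
        Q φ (slope (a u) (b u) y) * ∑ j, sForm a b u j * y j)) •
      bUp a b u

theorem wA_mul_Q {B s : ℝ} (h : RegularAt φ B s) : wA φ s * Q φ s = wB φ s := by
  have h1 := h.regular.ne'
  rw [wA, Q, wB]
  field_simp

/-- Balance of the coefficients of `y_l` when the fundamental tensor is applied to the spray
difference; `wA_mul_Q` does this for `s_{l0}` and `wA_mul_Psi` for `b_l`. -/
theorem wA_mul_Theta {B s : ℝ} (h : RegularAt φ B s) :
    wA φ s * Theta φ B s + wA' φ s * (B - s ^ 2) * Psi φ B s = wA' φ s / 2 := by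
  have h1 := h.regular.ne'
  have h2 := h.convex.ne'
  have h3 := h.pos.ne'
  rw [h.Theta_eq, h.Psi_eq, wA, wA', wB, wB']
  -- The convexity expression is made one symbol so that `field_simp` clears it as a single
  -- denominator; it is expanded again before `ring`.
  generalize hZ : φ s - s * deriv φ s + (B - s ^ 2) * deriv (deriv φ) s = Z at *
  field_simp
  rw [← hZ]
  ring

theorem wA_mul_Psi {B s : ℝ} (h : RegularAt φ B s) :
    wA φ s * Psi φ B s + wA' φ s * (Theta φ B s + s * Psi φ B s) +
      wB' φ s * (s * Theta φ B s + B * Psi φ B s) = wB' φ s / 2 := by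
  have h1 := h.regular.ne'
  have h2 := h.convex.ne'
  have h3 := h.pos.ne'
  rw [h.Theta_eq, h.Psi_eq, wA, wA', wB, wB']
  generalize hZ : φ s - s * deriv φ s + (B - s ^ 2) * deriv (deriv φ) s = Z at *
  field_simp
  rw [← hZ]
  ring

/-- Determinant of the 2×2 system met in proving the fundamental tensor invertible; the regularity
conditions make it positive. -/
theorem determinant_eq (φ : ℝ → ℝ) (B s : ℝ) :
    wA φ s * (wA φ s + s * wA' φ s + wB' φ s * B) - wB φ s * (wA' φ s * (B - s ^ 2)) =
      φ s ^ 3 * (φ s - s * deriv φ s + (B - s ^ 2) * deriv (deriv φ) s) := by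
  rw [wA, wA', wB, wB']
  ring

theorem form_eq_slope_mul (hy : 0 < quad (a u) y) :
    b u ⬝ᵥ y.ofLp = slope (a u) (b u) y * Real.sqrt (quad (a u) y) :=
  (div_mul_cancel₀ _ (Real.sqrt_pos.2 hy).ne').symm

theorem mulVec_dotProduct_bUp (hsymm : (a u).IsSymm) (hdet : IsUnit (a u).det)
    (v : Fin n → ℝ) : (a u *ᵥ v) ⬝ᵥ bUp a b u = b u ⬝ᵥ v := by
  rw [mulVec_dotProduct hsymm, mulVec_bUp hdet, dotProduct_comm]

theorem isUnit_det_fundamentalTensor (hJ : IsOpen J) (hφ : ContDiffOn ℝ ∞ φ J)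
    (hsymm : (a u).IsSymm) (hdet : IsUnit (a u).det)
    (hy : 0 < quad (a u) y) (hs : slope (a u) (b u) y ∈ J)
    (hreg : RegularAt φ (normSq a b u) (slope (a u) (b u) y)) :
    IsUnit (fundamentalTensor (abMetric φ a b) u y).det := by
  refine isUnit_det_of_injective fun v hv => ?_
  have hα := Real.sqrt_pos.2 hy
  have hα2 := Real.sq_sqrt hy.le
  have h1 : wA φ (slope (a u) (b u) y) • (a u *ᵥ v) +
      (wA' φ (slope (a u) (b u) y) / Real.sqrt (quad (a u) y) * (b u ⬝ᵥ v) -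
        slope (a u) (b u) y * wA' φ (slope (a u) (b u) y) / Real.sqrt (quad (a u) y) ^ 2 *
          ((a u *ᵥ y.ofLp) ⬝ᵥ v)) • (a u *ᵥ y.ofLp) +
      (wA' φ (slope (a u) (b u) y) / Real.sqrt (quad (a u) y) * ((a u *ᵥ y.ofLp) ⬝ᵥ v) +
        wB' φ (slope (a u) (b u) y) * (b u ⬝ᵥ v)) • b u = 0 := by
    rw [← hv]
    ext i
    rw [fundamentalTensor_mulVec hJ hφ hsymm hy hs]
    rfl
  -- Contracting `g v = 0` with `y` and with `b^i` gives two linear equations for `Y = y_i v^i` and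
  -- `X = b_i v^i`. Once both vanish, `g v` is `wA` times `a v`, so `v = 0`.
  have h2 := congrArg (fun w => w ⬝ᵥ y.ofLp) h1
  have h3 := congrArg (fun w => w ⬝ᵥ bUp a b u) h1
  have h4 : (a u *ᵥ y.ofLp) ⬝ᵥ y.ofLp = Real.sqrt (quad (a u) y) ^ 2 := by
    rw [hα2, dotProduct_comm, dotProduct_mulVec_eq_quad]
  have h5 : (a u *ᵥ v) ⬝ᵥ y.ofLp = (a u *ᵥ y.ofLp) ⬝ᵥ v := by
    rw [mulVec_dotProduct hsymm, dotProduct_comm]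
  simp only [add_dotProduct, smul_dotProduct, smul_eq_mul, mulVec_dotProduct_bUp hsymm hdet,
    dotProduct_bUp, form_eq_slope_mul hy, zero_dotProduct, h4, h5] at h2 h3
  generalize (a u *ᵥ y.ofLp) ⬝ᵥ v = Y at *
  generalize hX : b u ⬝ᵥ v = X at *
  have hdet' := determinant_eq φ (normSq a b u) (slope (a u) (b u) y)
  have hd : 0 < φ (slope (a u) (b u) y) ^ 3 * _ := mul_pos (pow_pos hreg.pos 3) hreg.convex
  have hwA : 0 < wA φ (slope (a u) (b u) y) := mul_pos hreg.pos hreg.regular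
  have hwB : wB φ (slope (a u) (b u) y) = wA' φ (slope (a u) (b u) y) +
    slope (a u) (b u) y * wB' φ (slope (a u) (b u) y) := by rw [wA']; ring
  rw [← hdet', hwB] at hd
  generalize slope (a u) (b u) y = s at *
  generalize √(quad (a u) y) = α at *
  generalize normSq a b u = B at *
  generalize wA φ s = p at *
  generalize wA' φ s = k at *
  generalize wB' φ s = m at *
  have e1 : p * Y + α * (k + s * m) * X = 0 := by
    rw [← h2]; field_simp; ring
  have e2 : (p + s * k + m * B) * X * α + k * (B - s ^ 2) * Y = 0 := by
    have : (p + s * k + m * B) * X * α + k * (B - s ^ 2) * Y = α * 0 := by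
      rw [← h3]; field_simp; ring
    rw [this, mul_zero]
  have hX0 : X = 0 := by
    have : (p * (p + s * k + m * B) - (k + s * m) * (k * (B - s ^ 2))) * α * X = 0 := by
      linear_combination p * e2 - k * (B - s ^ 2) * e1
    exact (mul_eq_zero.1 this).resolve_left (mul_pos hd hα).ne'
  have hY0 : Y = 0 := by
    rw [hX0, mul_zero, add_zero] at e1
    exact (mul_eq_zero.1 e1).resolve_left hwA.ne'
  rw [hX0, hY0] at h1
  simp only [mul_zero, sub_zero, add_zero, zero_smul, smul_eq_zero, hwA.ne', false_or] at h1
  have h6 := congrArg (fun w => (a u)⁻¹ *ᵥ w) h1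
  simpa only [Matrix.mulVec_mulVec, Matrix.nonsing_inv_mul _ hdet, Matrix.one_mulVec,
    Matrix.mulVec_zero] using h6

theorem fundamentalTensor_mulVec_spray (hJ : IsOpen J) (hφ : ContDiffOn ℝ ∞ φ J)
    (hsymm : ∀ u', (a u').IsSymm) (hdet : IsUnit (a u).det)
    (ha : ∀ i j, DifferentiableAt ℝ (fun u' => a u' i j) u)
    (hb : ∀ i, DifferentiableAt ℝ (fun u' => b u' i) u)
    (hy : 0 < quad (a u) y) (hs : slope (a u) (b u) y ∈ J)
    (hreg : RegularAt φ (normSq a b u) (slope (a u) (b u) y)) (l : Fin n) :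
    4 * (fundamentalTensor (abMetric φ a b) u y *ᵥ
        (geodesicCoeff a u y + sprayDiff φ a b u y)) l =
      (∑ k, pd k (fun u' => pd l (fun y' => abMetric φ a b u' y' ^ 2) y) u * y k)
        - pd l (fun u' => abMetric φ a b u' y ^ 2) u := by
  have hα := Real.sqrt_pos.2 hy
  have hα2 := Real.sq_sqrt hy.le
  rw [sum_pd_left_pd_sq_abMetric hJ hφ hsymm ha hb hy hs, pd_left_sq_abMetric hJ hφ ha hb hy hs,
    fundamentalTensor_mulVec hJ hφ (hsymm u) hy hs, ← dotProduct_geodesicCoeff y hsymm hdet]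
  have e1 := mulVec_geodesicCoeff y hdet l
  have e2 := rTensor_quadratic (a := a) (b := b) (u := u) y
  have e3 := sTensor_apply (b := b) (u := u) y hsymm l
  have h4 : (a u *ᵥ y.ofLp) ⬝ᵥ y.ofLp = Real.sqrt (quad (a u) y) ^ 2 := by
    rw [hα2, dotProduct_comm, dotProduct_mulVec_eq_quad]
  have h5 : (a u *ᵥ y.ofLp) ⬝ᵥ ((a u)⁻¹ *ᵥ (Matrix.of (sTensor a b u) *ᵥ y.ofLp)) = 0 := by
    rw [mulVec_dotProduct (hsymm u), mulVec_inv_mulVec hdet]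
    exact dotProduct_antisymm (fun i j => sTensor_antisymm i j) _
  have h6 : b u ⬝ᵥ ((a u)⁻¹ *ᵥ (Matrix.of (sTensor a b u) *ᵥ y.ofLp)) =
      ∑ j, sForm a b u j * y j := by
    rw [sForm_dotProduct, ← mulVec_bUp (b := b) hdet, mulVec_dotProduct (hsymm u),
      mulVec_inv_mulVec hdet]
  have i1 := wA_mul_Q hreg
  have i2 := wA_mul_Theta hreg
  have i3 := wA_mul_Psi hreg
  simp only [sprayDiff, Matrix.mulVec_add, Matrix.mulVec_smul, dotProduct_add, dotProduct_smul,
    smul_eq_mul, mulVec_inv_mulVec hdet, mulVec_bUp hdet, h4, h5, h6, form_eq_slope_mul hy,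
    mulVec_dotProduct_bUp (hsymm u) hdet, dotProduct_bUp, Pi.add_apply, Pi.smul_apply]
  have hwB : wB φ (slope (a u) (b u) y) = wA' φ (slope (a u) (b u) y) +
    slope (a u) (b u) y * wB' φ (slope (a u) (b u) y) := by rw [wA']; ring
  rw [hwB] at i1 ⊢
  generalize Matrix.of (sTensor a b u) *ᵥ y.ofLp = σ at *
  generalize ∑ i, ∑ j, rTensor a b u i j * y i * y j = r00 at *
  generalize ∑ j, sForm a b u j * y j = s0 at *
  generalize ∑ k, (∑ j, pd k (fun u' => a u' l j) u * y j) * y k = N at *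
  generalize ∑ i, ∑ j, pd l (fun u' => a u' i j) u * y i * y j = dA at *
  generalize ∑ k, (∑ i, pd k (fun u' => b u' i) u * y i) * y k = β0 at *
  generalize ∑ k, pd k (fun u' => b u' l) u * y k = M at *
  generalize ∑ i, pd l (fun u' => b u' i) u * y i = dβ at *
  generalize (a u *ᵥ y.ofLp) ⬝ᵥ geodesicCoeff a u y = yγ at *
  generalize b u ⬝ᵥ geodesicCoeff a u y = bγ at *
  generalize (a u *ᵥ geodesicCoeff a u y) l = aγ at *
  generalize (a u *ᵥ y.ofLp) l = w at *
  generalize σ l = σl at *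
  generalize √(quad (a u) y) = α at *
  generalize normSq a b u = B at *
  generalize slope (a u) (b u) y = s at *
  generalize Theta φ B s = Θ at *
  generalize Psi φ B s = Ψ at *
  generalize Q φ s = q at *
  generalize wA φ s = p at *
  generalize wA' φ s = k at *
  generalize wB' φ s = m at *
  obtain rfl : N = (4 * aγ + dA) / 2 := by linarith
  obtain rfl : β0 = r00 + 2 * bγ := by linarith
  obtain rfl : M = 2 * σl + dβ := by linarith
  -- `R = r₀₀ - 2αQ s₀` is the common factor of the `y`- and `b`-components of the spray difference.
  obtain ⟨R, rfl⟩ : ∃ R, r00 = R + 2 * α * q * s0 := ⟨r00 - 2 * α * q * s0, by ring⟩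
  -- The three identities are weighted by the terms they balance: `s_{l0}`, `y_l` and `b_l`.
  linear_combination (norm := skip) 4 * α * σl * i1 + 4 * R / α * w * i2 + 4 * R * b u l * i3
  field_simp
  ring

theorem sprayCoeff_abMetric (hJ : IsOpen J) (hφ : ContDiffOn ℝ ∞ φ J)
    (hsymm : ∀ u', (a u').IsSymm) (hdet : IsUnit (a u).det)
    (ha : ∀ i j, DifferentiableAt ℝ (fun u' => a u' i j) u)
    (hb : ∀ i, DifferentiableAt ℝ (fun u' => b u' i) u)
    (hy : 0 < quad (a u) y) (hs : slope (a u) (b u) y ∈ J)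
    (hreg : RegularAt φ (normSq a b u) (slope (a u) (b u) y)) (i : Fin n) :
    sprayCoeff (abMetric φ a b) u y i = geodesicCoeff a u y i + sprayDiff φ a b u y i := by
  have h1 := isUnit_det_fundamentalTensor hJ hφ (hsymm u) hdet hy hs hreg
  rw [sprayCoeff]
  simp only [← fundamentalTensor_mulVec_spray hJ hφ hsymm hdet ha hb hy hs hreg]
  generalize fundamentalTensor (abMetric φ a b) u y = g at *
  change _ = (geodesicCoeff a u y + sprayDiff φ a b u y) i
  generalize geodesicCoeff a u y + sprayDiff φ a b u y = G
  have h2 : (g⁻¹ *ᵥ (g *ᵥ G)) i = G i := by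
    rw [Matrix.mulVec_mulVec, Matrix.nonsing_inv_mul _ h1, Matrix.one_mulVec]
  rw [← h2]
  generalize g *ᵥ G = w
  rw [Matrix.mulVec, dotProduct, Finset.mul_sum]
  exact Finset.sum_congr rfl fun l _ => by ring

end Spray

/-! ### The divergence of the spray difference in `y`. -/

section Divergence

variable {n : ℕ}

theorem HasGrad.smul_add_smul {f g : EuclideanSpace ℝ (Fin n) → ℝ} {c d : Fin n → ℝ}
    {x : EuclideanSpace ℝ (Fin n)} (hf : HasGrad f c x) (hg : HasGrad g d x) :
    HasGrad (fun y => f y * g y) (f x • d + g x • c) x :=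
  hf.mul hg

theorem HasGrad.comp_smul {f : EuclideanSpace ℝ (Fin n) → ℝ} {c : Fin n → ℝ}
    {x : EuclideanSpace ℝ (Fin n)} {F : ℝ → ℝ} (hF : ContDiffAt ℝ ∞ F (f x))
    (hf : HasGrad f c x) : HasGrad (fun y => F (f y)) (deriv F (f x) • c) x :=
  hf.comp hF.hasDerivAt_deriv

theorem hasGrad_mulVec (T : Matrix (Fin n) (Fin n) ℝ) (m : Fin n)
    (y : EuclideanSpace ℝ (Fin n)) :
    HasGrad (fun y' : EuclideanSpace ℝ (Fin n) => (T *ᵥ y'.ofLp) m) (fun i => T m i) y :=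
  HasGrad.linear fun i => T m i

theorem sum_pd_vectorField {f₁ f₂ f₃ : EuclideanSpace ℝ (Fin n) → ℝ} {c₁ c₂ c₃ : Fin n → ℝ}
    {y : EuclideanSpace ℝ (Fin n)} (h₁ : HasGrad f₁ c₁ y) (h₂ : HasGrad f₂ c₂ y)
    (h₃ : HasGrad f₃ c₃ y) (T : Matrix (Fin n) (Fin n) ℝ) (v : Fin n → ℝ) :
    ∑ m, pd m (fun y' => f₁ y' * (T *ᵥ y'.ofLp) m + f₂ y' * y' m + f₃ y' * v m) y =
      f₁ y * T.trace + c₁ ⬝ᵥ (T *ᵥ y.ofLp) + (n * f₂ y + c₂ ⬝ᵥ y.ofLp) + c₃ ⬝ᵥ v := by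
  have h : ∀ m, pd m (fun y' => f₁ y' * (T *ᵥ y'.ofLp) m + f₂ y' * y' m + f₃ y' * v m) y =
      f₁ y * T m m + c₁ m * (T *ᵥ y.ofLp) m + (f₂ y + c₂ m * y m) + c₃ m * v m := fun m => by
    refine ((((h₁.mul (hasGrad_mulVec T m y)).add (h₂.mul (HasGrad.coord m))).add
      (h₃.mul_const (v m))).pd_eq m).trans ?_
    rw [if_pos rfl]
    ring
  simp only [h, Finset.sum_add_distrib, ← Finset.mul_sum, Finset.sum_const, Finset.card_univ,
    Fintype.card_fin, nsmul_eq_mul]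
  rfl

theorem trace_mul_antisymm {A S : Matrix (Fin n) (Fin n) ℝ} (hA : A.IsSymm)
    (hS : ∀ i j, S i j = -S j i) : (A * S).trace = 0 := by
  have h1 : Sᵀ = -S := by
    ext i j
    simp [hS j i]
  have h2 : (A * S).trace = -(A * S).trace := by
    conv_lhs => rw [← Matrix.trace_transpose, Matrix.transpose_mul, h1, hA.eq, Matrix.neg_mul,
      Matrix.trace_neg, Matrix.trace_mul_comm]
  linarith

variable {φ : ℝ → ℝ} {J : Set ℝ}
  {a : EuclideanSpace ℝ (Fin n) → Matrix (Fin n) (Fin n) ℝ}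
  {b : EuclideanSpace ℝ (Fin n) → Fin n → ℝ} {u y : EuclideanSpace ℝ (Fin n)}

theorem rForm_dotProduct :
    ∑ j, rForm a b u j * y j = (Matrix.of (rTensor a b u) *ᵥ y.ofLp) ⬝ᵥ bUp a b u := by
  rw [dotProduct_comm, Matrix.dotProduct_mulVec]
  rfl

theorem rTensor_symm (i j : Fin n) : rTensor a b u i j = rTensor a b u j i := by
  rw [rTensor, rTensor, add_comm]

theorem sForm_dotProduct_bUp : sForm a b u ⬝ᵥ bUp a b u = 0 := by
  have h1 : sForm a b u = bUp a b u ᵥ* Matrix.of (sTensor a b u) := rfl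
  rw [h1, ← Matrix.dotProduct_mulVec]
  exact dotProduct_antisymm (fun i j => sTensor_antisymm i j) _

theorem rTensor_eq_dotProduct :
    ∑ i, ∑ j, rTensor a b u i j * y i * y j =
      (Matrix.of (rTensor a b u) *ᵥ y.ofLp) ⬝ᵥ y.ofLp := by
  rw [dotProduct_comm, dotProduct_mulVec_eq_quad]
  rfl

theorem hasGrad_rTensor :
    HasGrad (fun y => ∑ i, ∑ j, rTensor a b u i j * y i * y j)
      ((2 : ℝ) • (Matrix.of (rTensor a b u) *ᵥ y.ofLp)) y :=
  hasGrad_quad (a := Matrix.of (rTensor a b u)) (Matrix.IsSymm.ext fun i j => rTensor_symm j i) y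

/-- Most contractions vanish: `y_i s^i_0 = 0`, `s_j b^j = 0`, and `a⁻¹ s` has trace zero. The
`s^i_0` part contributes only `Q' s₀`, through `b_i s^i_0 = s₀`. -/
theorem sum_pd_sprayDiff (hsymm : (a u).IsSymm) (hdet : IsUnit (a u).det)
    (hy : 0 < quad (a u) y)
    (hreg : RegularAt φ (normSq a b u) (slope (a u) (b u) y)) :
    ∑ m, pd m (fun y' => sprayDiff φ a b u y' m) y =
      2 * Psi φ (normSq a b u) (slope (a u) (b u) y) *
        (∑ j, rForm a b u j * y j + ∑ j, sForm a b u j * y j) -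
      Omega n φ (normSq a b u) (slope (a u) (b u) y) *
        ((∑ i, ∑ j, rTensor a b u i j * y i * y j) / Real.sqrt (quad (a u) y) -
          2 * Q φ (slope (a u) (b u) y) * ∑ j, sForm a b u j * y j) := by
  have hα := Real.sqrt_pos.2 hy
  have hα2 := Real.sq_sqrt hy.le
  have g1 : HasGrad (fun y => Real.sqrt (quad (a u) y))
      ((1 / Real.sqrt (quad (a u) y)) • (a u *ᵥ y.ofLp)) y :=
    ((hasGrad_quad hsymm y).sqrt hy).congr fun i => by
      rw [mul_div_mul_left _ _ two_ne_zero, Pi.smul_apply, smul_eq_mul]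
      ring
  have g2 : HasGrad (slope (a u) (b u)) ((1 / Real.sqrt (quad (a u) y)) • b u -
      (slope (a u) (b u) y / Real.sqrt (quad (a u) y) ^ 2) • (a u *ᵥ y.ofLp)) y :=
    (hasGrad_slope hsymm (b u) hy).congr fun i => by
      simp only [Pi.sub_apply, Pi.smul_apply, smul_eq_mul]
      field_simp
  have g3 : HasGrad (fun y => ∑ j, sForm a b u j * y j) (sForm a b u) y := .linear _
  have g4 := hasGrad_rTensor (a := a) (b := b) (u := u) (y := y)
  have g5 := g1.smul_add_smul (g2.comp_smul hreg.contDiffAt_Q)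
  have g6 : HasGrad (fun y => (∑ i, ∑ j, rTensor a b u i j * y i * y j) -
      2 * Real.sqrt (quad (a u) y) * Q φ (slope (a u) (b u) y) * ∑ j, sForm a b u j * y j)
      ((2 : ℝ) • (Matrix.of (rTensor a b u) *ᵥ y.ofLp) -
        (2 : ℝ) • ((Real.sqrt (quad (a u) y) * Q φ (slope (a u) (b u) y)) • sForm a b u +
          (∑ j, sForm a b u j * y j) • (Real.sqrt (quad (a u) y) •
            deriv (Q φ) (slope (a u) (b u) y) • ((1 / Real.sqrt (quad (a u) y)) • b u -
              (slope (a u) (b u) y / Real.sqrt (quad (a u) y) ^ 2) • (a u *ᵥ y.ofLp)) +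
            Q φ (slope (a u) (b u) y) • (1 / Real.sqrt (quad (a u) y)) • (a u *ᵥ y.ofLp)))) y := by
    refine HasGrad.congr_eventually (g4.sub ((g5.smul_add_smul g3).const_mul 2))
      (.of_forall fun y => ?_)
    ring
  have g7 := (g2.comp_smul hreg.contDiffAt_Psi).smul_add_smul g6
  have g8 := ((g2.comp_smul hreg.contDiffAt_Theta).smul_add_smul g6).smul_add_smul
    (g1.comp_smul (F := fun t => t⁻¹) (contDiffAt_inv ℝ hα.ne'))
  have h4 : (a u *ᵥ y.ofLp) ⬝ᵥ y.ofLp = Real.sqrt (quad (a u) y) ^ 2 := by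
    rw [hα2, dotProduct_comm, dotProduct_mulVec_eq_quad]
  have h5 : (a u *ᵥ y.ofLp) ⬝ᵥ (((a u)⁻¹ * Matrix.of (sTensor a b u)) *ᵥ y.ofLp) = 0 := by
    rw [← Matrix.mulVec_mulVec, mulVec_dotProduct hsymm, mulVec_inv_mulVec hdet]
    exact dotProduct_antisymm (fun i j => sTensor_antisymm i j) _
  have h6 : b u ⬝ᵥ (((a u)⁻¹ * Matrix.of (sTensor a b u)) *ᵥ y.ofLp) =
      ∑ j, sForm a b u j * y j := by
    rw [← Matrix.mulVec_mulVec, sForm_dotProduct, ← mulVec_bUp (b := b) hdet,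
      mulVec_dotProduct hsymm, mulVec_inv_mulVec hdet]
  have h7 : sForm a b u ⬝ᵥ y.ofLp = ∑ j, sForm a b u j * y j := rfl
  have h8 : ((a u)⁻¹ * Matrix.of (sTensor a b u)).trace = 0 := by
    refine trace_mul_antisymm ?_ fun i j => sTensor_antisymm i j
    rw [Matrix.IsSymm, Matrix.transpose_nonsing_inv, hsymm.eq]
  have h9 := sum_pd_vectorField g5 g8 g7 ((a u)⁻¹ * Matrix.of (sTensor a b u)) (bUp a b u)
  refine (Finset.sum_congr rfl fun m _ =>
    congrArg (fun f => pd m f y) (funext fun y' => ?_)).trans (h9.trans ?_)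
  · rw [sprayDiff, Matrix.mulVec_mulVec, div_eq_mul_inv]
    rfl
  simp only [add_dotProduct, sub_dotProduct, smul_dotProduct, smul_eq_mul, h4, h5, h6, h7, h8,
    mulVec_dotProduct_bUp hsymm hdet, dotProduct_bUp, form_eq_slope_mul hy, sForm_dotProduct_bUp,
    ← rForm_dotProduct, ← rTensor_eq_dotProduct, deriv_inv]
  have i1 := hreg.Theta_add_deriv_Psi n
  have i2 := hreg.Psi_mul_Delta
  -- The terms in `Θ` and `Ψ'` share the factor `(r₀₀ - 2αQ s₀) / α`; the leftover terms in `Q'` and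
  -- `ΨΔ` share `s₀`.
  linear_combination (norm := skip) ((∑ i, ∑ j, rTensor a b u i j * y i * y j) -
    2 * Real.sqrt (quad (a u) y) * Q φ (slope (a u) (b u) y) * ∑ j, sForm a b u j * y j) /
    Real.sqrt (quad (a u) y) * i1 - (∑ j, sForm a b u j * y j) * i2
  generalize Real.sqrt (quad (a u) y) = α at *
  generalize slope (a u) (b u) y = s at *
  generalize (∑ i, ∑ j, rTensor a b u i j * y i * y j) = r00 at *
  generalize ∑ j, sForm a b u j * y j = s0 at *
  field_simp
  ring

end Divergence

/-! ### The S-curvature modulo linear terms, and Hessians of its ingredients. -/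

section ECurvature

variable {n : ℕ} {φ : ℝ → ℝ} {J : Set ℝ}
  {a : EuclideanSpace ℝ (Fin n) → Matrix (Fin n) (Fin n) ℝ}
  {b : EuclideanSpace ℝ (Fin n) → Fin n → ℝ} {u y : EuclideanSpace ℝ (Fin n)}

/-- The S-curvature of `α φ(β / α)` up to a term which is linear in `y`. -/
def sCurvMain (φ : ℝ → ℝ) (a : EuclideanSpace ℝ (Fin n) → Matrix (Fin n) (Fin n) ℝ)
    (b : EuclideanSpace ℝ (Fin n) → Fin n → ℝ) (u y : EuclideanSpace ℝ (Fin n)) : ℝ :=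
  2 * (Psi φ (normSq a b u) (slope (a u) (b u) y) * ∑ j, (rForm a b u j + sForm a b u j) * y j) +
    2 * (Omega n φ (normSq a b u) (slope (a u) (b u) y) * Q φ (slope (a u) (b u) y) *
      ∑ j, sForm a b u j * y j) +
    -1 * (Omega n φ (normSq a b u) (slope (a u) (b u) y) * ((Real.sqrt (quad (a u) y))⁻¹ *
      ∑ i, ∑ j, rTensor a b u i j * y i * y j))

theorem hasGrad_geodesicCoeff (i : Fin n) :
    HasGrad (fun y => geodesicCoeff a u y i)
      (fun m => 1 / 2 * ∑ j, (christoffel a u i m j + christoffel a u i j m) * y j) y :=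
  (HasGrad.quadratic (christoffel a u i)).const_mul _

theorem contDiffAt_linear (c : Fin n → ℝ) :
    ContDiffAt ℝ ∞ (fun y : EuclideanSpace ℝ (Fin n) => ∑ i, c i * y i) y := by
  fun_prop

theorem contDiffAt_quad (A : Matrix (Fin n) (Fin n) ℝ) : ContDiffAt ℝ ∞ (quad A) y := by
  unfold quad
  fun_prop

theorem contDiffAt_slope {A : Matrix (Fin n) (Fin n) ℝ} (c : Fin n → ℝ) (hy : 0 < quad A y) :
    ContDiffAt ℝ ∞ (slope A c) y :=
  (contDiffAt_linear c).div ((contDiffAt_quad A).sqrt hy.ne') (Real.sqrt_pos.2 hy).ne'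

theorem differentiableAt_sprayDiff (hy : 0 < quad (a u) y)
    (hr : RegularAt φ (normSq a b u) (slope (a u) (b u) y)) (m : Fin n) :
    DifferentiableAt ℝ (fun y' => sprayDiff φ a b u y' m) y := by
  have h1 := contDiffAt_slope (b u) hy
  have h2 := hr.contDiffAt_Q.comp y h1
  have h3 := hr.contDiffAt_Psi.comp y h1
  have h4 := hr.contDiffAt_Theta.comp y h1
  have h5 := (contDiffAt_quad (a u)).sqrt hy.ne'
  have h6 := (contDiffAt_quad (y := y) (Matrix.of (rTensor a b u))).sub
    (((contDiffAt_const (c := (2 : ℝ)).mul h5).mul h2).mul (contDiffAt_linear (sForm a b u)))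
  have h7 : ContDiffAt ℝ ∞ (fun y' : EuclideanSpace ℝ (Fin n) =>
      ((a u)⁻¹ *ᵥ (Matrix.of (sTensor a b u) *ᵥ y'.ofLp)) m) y := by
    simp only [Matrix.mulVec_mulVec]
    exact contDiffAt_linear _
  have h8 : ContDiffAt ℝ ∞ (fun y' : EuclideanSpace ℝ (Fin n) => y' m) y := by fun_prop
  exact ((((h5.mul h2).mul h7).add
    (((h4.mul h6).div h5 (Real.sqrt_pos.2 hy).ne').mul h8)).add
    ((h3.mul h6).mul contDiffAt_const)).differentiableAt (by simp)

theorem sum_pd_sprayCoeff (hJ : IsOpen J) (hφ : ContDiffOn ℝ ∞ φ J)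
    (hsymm : ∀ u', (a u').IsSymm) (hdet : IsUnit (a u).det)
    (ha : ∀ i j, DifferentiableAt ℝ (fun u' => a u' i j) u)
    (hb : ∀ i, DifferentiableAt ℝ (fun u' => b u' i) u)
    (hreg : ∀ y, 0 < quad (a u) y → slope (a u) (b u) y ∈ J →
      RegularAt φ (normSq a b u) (slope (a u) (b u) y))
    (hy : 0 < quad (a u) y) (hs : slope (a u) (b u) y ∈ J) :
    ∑ m, pd m (fun y' => sprayCoeff (abMetric φ a b) u y' m) y =
      sCurvMain φ a b u y + ∑ j, (∑ m, christoffel a u m m j) * y j := by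
  have hr := hreg y hy hs
  have h1 : ∀ m, pd m (fun y' => sprayCoeff (abMetric φ a b) u y' m) y =
      ∑ j, christoffel a u m m j * y j + pd m (fun y' => sprayDiff φ a b u y' m) y := by
    intro m
    -- The spray formula is differentiated, so it must hold on a neighbourhood of `y`; this is why
    -- regularity is assumed at all admissible vectors over `u`.
    have h2 : (fun y' => sprayCoeff (abMetric φ a b) u y' m) =ᶠ[nhds y] _ :=
      (eventually_mem_domain hJ (hsymm u) hy hs).mono fun y' hy' =>
        sprayCoeff_abMetric hJ hφ hsymm hdet ha hb hy'.1 hy'.2 (hreg y' hy'.1 hy'.2) m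
    rw [pd_congr h2, (HasGrad.add (hasGrad_geodesicCoeff m)
      (differentiableAt_sprayDiff hy hr m).hasGrad).pd_eq]
    congr 1
    rw [Finset.mul_sum]
    refine Finset.sum_congr rfl fun j _ => ?_
    rw [christoffel_symm hsymm m j m]
    ring
  simp only [h1, Finset.sum_add_distrib, sum_pd_sprayDiff (hsymm u) hdet hy hr, sCurvMain,
    add_mul, Finset.sum_mul]
  rw [Finset.sum_comm]
  ring

/-- For fixed `u` the partial derivatives of `ln σ` are constants in `y`, whatever `D` is, so no
differentiability of the density is needed. -/
theorem sCurv_abMetric (D : EuclideanSpace ℝ (Fin n) → Set (EuclideanSpace ℝ (Fin n)))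
    (hJ : IsOpen J) (hφ : ContDiffOn ℝ ∞ φ J)
    (hsymm : ∀ u', (a u').IsSymm) (hdet : IsUnit (a u).det)
    (ha : ∀ i j, DifferentiableAt ℝ (fun u' => a u' i j) u)
    (hb : ∀ i, DifferentiableAt ℝ (fun u' => b u' i) u)
    (hreg : ∀ y, 0 < quad (a u) y → slope (a u) (b u) y ∈ J →
      RegularAt φ (normSq a b u) (slope (a u) (b u) y))
    (hy : 0 < quad (a u) y) (hs : slope (a u) (b u) y ∈ J) :
    sCurv D (abMetric φ a b) u =ᶠ[nhds y] fun y' => sCurvMain φ a b u y' +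
      ∑ j, (∑ m, christoffel a u m m j -
        pd j (fun u' => Real.log (bhDensity D (abMetric φ a b) u')) u) * y' j := by
  filter_upwards [eventually_mem_domain hJ (hsymm u) hy hs] with y' hy'
  rw [sCurv, sum_pd_sprayCoeff hJ hφ hsymm hdet ha hb hreg hy'.1 hy'.2, add_sub_assoc,
    ← Finset.sum_sub_distrib]
  congr 1
  exact Finset.sum_congr rfl fun j _ => by ring

theorem contDiffAt_sCurvMain (hy : 0 < quad (a u) y)
    (hr : RegularAt φ (normSq a b u) (slope (a u) (b u) y)) :
    ContDiffAt ℝ ∞ (sCurvMain φ a b u) y := by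
  have h1 := contDiffAt_slope (b u) hy
  have h2 := hr.contDiffAt_Q.comp y h1
  have h3 := hr.contDiffAt_Psi.comp y h1
  have h4 := (hr.contDiffAt_Omega n).comp y h1
  have h5 := ((contDiffAt_quad (a u)).sqrt hy.ne').inv (Real.sqrt_pos.2 hy).ne'
  exact ((contDiffAt_const.mul (h3.mul (contDiffAt_linear _))).add
    (contDiffAt_const.mul ((h4.mul h2).mul (contDiffAt_linear _)))).add
    (contDiffAt_const.mul (h4.mul (h5.mul (contDiffAt_quad (Matrix.of (rTensor a b u))))))

/-- Writing the derivative as a power of `(√r)⁻¹` lets the second derivative follow from the first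
by the power rule. -/
theorem eventually_hasDerivAt_inv_sqrt {t : ℝ} (ht : 0 < t) :
    ∀ᶠ r in nhds t, HasDerivAt (fun r => (Real.sqrt r)⁻¹) (-1 / 2 * (Real.sqrt r)⁻¹ ^ 3) r := by
  filter_upwards [lt_mem_nhds ht] with r hr
  have h1 := Real.sqrt_pos.2 hr
  refine ((Real.hasDerivAt_sqrt hr.ne').fun_inv h1.ne').congr_deriv ?_
  field_simp

theorem HasHess.inv_sqrt_quad {A : Matrix (Fin n) (Fin n) ℝ} (hA : A.IsSymm)
    (hy : 0 < quad A y) :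
    HasHess (fun y => (Real.sqrt (quad A y))⁻¹)
      (fun i => -(A *ᵥ y.ofLp) i / Real.sqrt (quad A y) ^ 3)
      (fun j i => 3 * (A *ᵥ y.ofLp) i * (A *ᵥ y.ofLp) j / Real.sqrt (quad A y) ^ 5 -
        A i j / Real.sqrt (quad A y) ^ 3) y := by
  have h1 := Real.sqrt_pos.2 hy
  have h2 := (eventually_hasDerivAt_inv_sqrt hy).self_of_nhds
  have h3 := (HasHess.quadratic (x := y) A).comp (eventually_hasDerivAt_inv_sqrt hy)
    ((h2.fun_pow 3).const_mul (-1 / 2))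
  have h4 : ∀ k, ∑ j, (A k j + A j k) * y j = 2 * (A *ᵥ y.ofLp) k := fun k => by
    rw [Matrix.mulVec, dotProduct, Finset.mul_sum]
    exact Finset.sum_congr rfl fun j _ => by rw [hA.apply k j]; ring
  refine h3.congr (fun i => ?_) fun j i => ?_
  · rw [h4]
    field_simp
  · rw [h4, h4, hA.apply i j]
    change -1 / 2 * (_ * (Real.sqrt (quad A y))⁻¹ ^ 2 * (-1 / 2 * (Real.sqrt (quad A y))⁻¹ ^ 3)) *
      _ * _ + -1 / 2 * (Real.sqrt (quad A y))⁻¹ ^ 3 * _ = _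
    push_cast
    field_simp
    ring

theorem HasHess.slope {A : Matrix (Fin n) (Fin n) ℝ} (hA : A.IsSymm) (c : Fin n → ℝ)
    (hy : 0 < quad A y) :
    HasHess (slope A c)
      (fun i => (c i - slope A c y * (A *ᵥ y.ofLp) i / Real.sqrt (quad A y)) /
        Real.sqrt (quad A y))
      (fun j i => -(c i * (A *ᵥ y.ofLp) j + c j * (A *ᵥ y.ofLp) i) / Real.sqrt (quad A y) ^ 3 -
        slope A c y * A i j / Real.sqrt (quad A y) ^ 2 +
        3 * slope A c y * ((A *ᵥ y.ofLp) i * (A *ᵥ y.ofLp) j) / Real.sqrt (quad A y) ^ 4) y := by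
  have h1 := Real.sqrt_pos.2 hy
  have h2 : c ⬝ᵥ y.ofLp = AlphaBeta.slope A c y * Real.sqrt (quad A y) :=
    (div_mul_cancel₀ _ h1.ne').symm
  rw [dotProduct] at h2
  refine ((HasHess.linear c).mul (HasHess.inv_sqrt_quad hA hy)).congr (fun i => ?_) fun j i => ?_
  · rw [h2]
    field_simp
    ring
  · rw [h2]
    field_simp
    ring

end ECurvature

/-! ### The Hessian of the S-curvature and its eleven coefficients. -/

section ECurvatureFormula

variable {n : ℕ}

theorem pd_pd_congr {f g : EuclideanSpace ℝ (Fin n) → ℝ} {x : EuclideanSpace ℝ (Fin n)}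
    (h : f =ᶠ[nhds x] g) (i j : Fin n) :
    pd i (fun y => pd j f y) x = pd i (fun y => pd j g y) x :=
  pd_congr (h.eventuallyEq_nhds.mono fun _ hy => pd_congr hy j) i

/-- The derivative `∂s/∂y^i` in terms of `α`, `s`, `y_i` and `b_i`. -/
def slopeGrad (α s w b : ℝ) : ℝ := (b - s * w / α) / α

/-- The derivative `∂²s/∂y^i∂y^j` in terms of `α`, `s`, `y_i`, `y_j`, `b_i`, `b_j` and `a_ij`. -/
def slopeHess (α s wi wj bi bj aij : ℝ) : ℝ :=
  -(bi * wj + bj * wi) / α ^ 3 - s * aij / α ^ 2 + 3 * s * (wi * wj) / α ^ 4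

/-- The derivative of `r₀₀ / α` in `y^i`. -/
def quotGrad (α w r00 ri : ℝ) : ℝ := 2 * ri / α - r00 * w / α ^ 3

/-- The second derivative of `r₀₀ / α` in `y^i` and `y^j`. -/
def quotHess (α wi wj aij r00 ri rj rij : ℝ) : ℝ :=
  2 * rij / α - 2 * (ri * wj + rj * wi) / α ^ 3 +
    r00 * (3 * wi * wj / α ^ 5 - aij / α ^ 3)

/-- The second derivative of `Ψ (r₀ + s₀) + Ω Q s₀ - (1/2) Ω r₀₀ / α`. -/
def sCurvHess (α s Ψ' Ψ'' Ω Ω' Ω'' q q' q'' r00 r0 s0 wi wj bi bj ri rj si sj r₁i r₁j aij rij : ℝ) :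
    ℝ :=
  (Ψ'' * (slopeGrad α s wi bi * slopeGrad α s wj bj) + Ψ' * slopeHess α s wi wj bi bj aij) *
      (r0 + s0) +
    Ψ' * (slopeGrad α s wi bi * (r₁j + sj) + slopeGrad α s wj bj * (r₁i + si)) +
    ((Ω'' * q + 2 * Ω' * q' + Ω * q'') * (slopeGrad α s wi bi * slopeGrad α s wj bj) +
      (Ω' * q + Ω * q') * slopeHess α s wi wj bi bj aij) * s0 +
    (Ω' * q + Ω * q') * (slopeGrad α s wi bi * sj + slopeGrad α s wj bj * si) -
    1 / 2 * ((Ω'' * (slopeGrad α s wi bi * slopeGrad α s wj bj) +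
        Ω' * slopeHess α s wi wj bi bj aij) * (r00 / α) +
      Ω' * (slopeGrad α s wi bi * quotGrad α wj r00 rj +
        slopeGrad α s wj bj * quotGrad α wi r00 ri) +
      Ω * quotHess α wi wj aij r00 ri rj rij)

/-- Pure algebra: all symbols are free apart from `Φ = 2Δ²Ω`. After this substitution `Δ` cancels
from every coefficient, leaving a rational identity with powers of `α` as denominators. -/
theorem sCurvHess_eq {α Δ Φ Ω : ℝ} (hα : α ≠ 0) (hΔ : Δ ≠ 0) (hΩ : Φ = 2 * Δ ^ 2 * Ω)
    (s Ψ' Ψ'' Ω' Ω'' q q' q'' r00 r0 s0 wi wj bi bj ri rj si sj r₁i r₁j aij rij : ℝ) :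
    let C₁ : ℝ := 1 / (2 * α ^ 3 * Δ ^ 2) *
      (Φ * α * q'' * s0 + 2 * α * Δ ^ 2 * Ψ'' * r0 - Δ ^ 2 * Ω'' * r00
        + 2 * Δ ^ 2 * α * Ω'' * q * s0 + 4 * Δ ^ 2 * α * Ω' * q' * s0
        + 2 * α * Δ ^ 2 * Ψ'' * s0)
    let C₂ : ℝ := -1 / (2 * α ^ 4 * Δ ^ 2) *
      (2 * α * Δ ^ 2 * Ψ' * s0 - 2 * Ω' * Δ ^ 2 * r00 + 2 * Ω' * Δ ^ 2 * α * q * s0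
        - Δ ^ 2 * Ω'' * s * r00 + 2 * Δ ^ 2 * α * Ω'' * s * q * s0
        + 4 * Δ ^ 2 * α * Ω' * q' * s0 * s + 2 * α * Δ ^ 2 * Ψ' * r0
        + 2 * α * Δ ^ 2 * Ψ'' * s * r0 + 2 * α * Δ ^ 2 * Ψ'' * s * s0
        + Φ * α * q' * s0 + Φ * α * q'' * s0 * s)
    let C₃ : ℝ := 1 / (4 * α ^ 5 * Δ ^ 2) *
      (4 * Δ ^ 2 * s ^ 2 * Ω'' * α * q * s0 - 2 * Δ ^ 2 * s ^ 2 * Ω'' * r00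
        + 12 * α * Δ ^ 2 * Ψ' * s * r0 + 12 * α * Δ ^ 2 * Ψ' * s * s0
        + 4 * α * Δ ^ 2 * Ψ'' * s ^ 2 * r0 + 4 * α * Δ ^ 2 * Ψ'' * s ^ 2 * s0
        + 8 * Δ ^ 2 * s ^ 2 * Ω' * α * q' * s0 + 2 * Φ * α * q'' * s0 * s ^ 2
        - 10 * Ω' * Δ ^ 2 * s * r00 + 12 * Ω' * Δ ^ 2 * s * α * q * s0
        + 6 * Φ * α * q' * s0 * s - 3 * Φ * r00)
    let C₄ : ℝ := -1 / (4 * α ^ 3 * Δ ^ 2) *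
      (4 * α * Δ ^ 2 * Ψ' * s * s0 - Φ * r00 - 2 * Ω' * Δ ^ 2 * s * r00
        + 4 * Ω' * Δ ^ 2 * s * α * q * s0 + 4 * α * Δ ^ 2 * Ψ' * s * r0
        + 2 * Φ * α * q' * s0 * s)
    let C₅ : ℝ := -Ω' / α ^ 2
    let C₆ : ℝ := (2 * Δ ^ 2 * s * Ω' + Φ) / (2 * α ^ 3 * Δ ^ 2)
    let C₇ : ℝ := -Φ / (2 * α * Δ ^ 2)
    let C₈ : ℝ := 1 / (2 * α * Δ ^ 2) * (2 * Ω' * Δ ^ 2 * q + 2 * Δ ^ 2 * Ψ' + Φ * q')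
    let C₉ : ℝ := -s / α * C₈
    let C₁₀ : ℝ := Ψ' / α
    let C₁₁ : ℝ := -s / α * C₁₀
    sCurvHess α s Ψ' Ψ'' Ω Ω' Ω'' q q' q'' r00 r0 s0 wi wj bi bj ri rj si sj r₁i r₁j aij rij =
      C₁ * (bi * bj) + C₂ * (bi * wj + bj * wi) + C₃ * (wi * wj) + C₄ * aij
        + C₅ * (ri * bj + rj * bi) + C₆ * (ri * wj + rj * wi) + C₇ * rij
        + C₈ * (si * bj + sj * bi) + C₉ * (si * wj + sj * wi)
        + C₁₀ * (r₁i * bj + r₁j * bi) + C₁₁ * (r₁i * wj + r₁j * wi) := by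
  intro C₁ C₂ C₃ C₄ C₅ C₆ C₇ C₈ C₉ C₁₀ C₁₁
  simp only [C₁, C₂, C₃, C₄, C₅, C₆, C₇, C₈, C₉, C₁₀, C₁₁, sCurvHess, slopeGrad, slopeHess,
    quotGrad, quotHess, hΩ]
  field_simp
  ring

variable {φ : ℝ → ℝ} {J : Set ℝ}
  {a : EuclideanSpace ℝ (Fin n) → Matrix (Fin n) (Fin n) ℝ}
  {b : EuclideanSpace ℝ (Fin n) → Fin n → ℝ} {u y : EuclideanSpace ℝ (Fin n)}

theorem hasHess_rTensor_div (hsymm : (a u).IsSymm) (hy : 0 < quad (a u) y) :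
    HasHess (fun y => (Real.sqrt (quad (a u) y))⁻¹ * ∑ i, ∑ j, rTensor a b u i j * y i * y j)
      (fun i => quotGrad (Real.sqrt (quad (a u) y)) ((a u *ᵥ y.ofLp) i)
        (∑ i, ∑ j, rTensor a b u i j * y i * y j) (∑ j, rTensor a b u i j * y j))
      (fun j i => quotHess (Real.sqrt (quad (a u) y)) ((a u *ᵥ y.ofLp) i) ((a u *ᵥ y.ofLp) j)
        (a u i j) (∑ i, ∑ j, rTensor a b u i j * y i * y j) (∑ k, rTensor a b u i k * y k)
        (∑ k, rTensor a b u j k * y k) (rTensor a b u i j)) y := by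
  have h1 := Real.sqrt_pos.2 hy
  have h2 : ∀ k, ∑ j, (rTensor a b u k j + rTensor a b u j k) * y j =
      2 * ∑ j, rTensor a b u k j * y j := fun k => by
    rw [Finset.mul_sum]
    exact Finset.sum_congr rfl fun j _ => by rw [rTensor_symm j k]; ring
  refine ((HasHess.inv_sqrt_quad hsymm hy).mul (HasHess.quadratic (rTensor a b u))).congr
    (fun i => ?_) fun j i => ?_
  · rw [h2, quotGrad]
    field_simp
    ring
  · rw [h2, h2, quotHess, rTensor_symm j i]
    field_simp
    ring

/-- The gradient stays existential, as only second derivatives reach the E-curvature. The factor 2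
will cancel the `1/2` in `E_ij`. -/
theorem hasHess_sCurvMain (hsymm : (a u).IsSymm) (hy : 0 < quad (a u) y)
    (hr : RegularAt φ (normSq a b u) (slope (a u) (b u) y)) :
    ∃ c, HasHess (sCurvMain φ a b u) c (fun j i => 2 * sCurvHess (Real.sqrt (quad (a u) y))
      (slope (a u) (b u) y)
      (deriv (Psi φ (normSq a b u)) (slope (a u) (b u) y))
      (deriv (deriv (Psi φ (normSq a b u))) (slope (a u) (b u) y))
      (Omega n φ (normSq a b u) (slope (a u) (b u) y))
      (deriv (Omega n φ (normSq a b u)) (slope (a u) (b u) y))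
      (deriv (deriv (Omega n φ (normSq a b u))) (slope (a u) (b u) y))
      (Q φ (slope (a u) (b u) y)) (deriv (Q φ) (slope (a u) (b u) y))
      (deriv (deriv (Q φ)) (slope (a u) (b u) y))
      (∑ i, ∑ j, rTensor a b u i j * y i * y j) (∑ j, rForm a b u j * y j)
      (∑ j, sForm a b u j * y j) ((a u *ᵥ y.ofLp) i) ((a u *ᵥ y.ofLp) j) (b u i) (b u j)
      (∑ k, rTensor a b u i k * y k) (∑ k, rTensor a b u j k * y k) (sForm a b u i)
      (sForm a b u j) (rForm a b u i) (rForm a b u j) (a u i j) (rTensor a b u i j)) y := by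
  have h1 := HasHess.slope hsymm (b u) hy
  have h2 := hasHess_rTensor_div (b := b) hsymm hy
  have h3 := h1.comp_contDiffAt hr.contDiffAt_Psi
  have h4 := h1.comp_contDiffAt (hr.contDiffAt_Omega n)
  have h5 := h1.comp_contDiffAt hr.contDiffAt_Q
  have h6 := (((h3.mul (HasHess.linear fun j => rForm a b u j + sForm a b u j)).const_mul 2).add
    (((h4.mul h5).mul (HasHess.linear (sForm a b u))).const_mul 2)).add ((h4.mul h2).const_mul (-1))
  refine ⟨_, h6.congr (fun _ => rfl) fun j i => ?_⟩
  have h7 : ∑ j, (rForm a b u j + sForm a b u j) * y j =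
      ∑ j, rForm a b u j * y j + ∑ j, sForm a b u j * y j := by
    simp only [add_mul, Finset.sum_add_distrib]
  rw [h7, sCurvHess, slopeGrad, slopeGrad, slopeHess]
  ring

end ECurvatureFormula

/-! ### The regularity conditions read in a chart. -/

section Chart

variable {n : ℕ} {M : Type*} [TopologicalSpace M] [ChartedSpace (EuclideanSpace ℝ (Fin n)) M]
  [IsManifold (𝓡 n) ∞ M] {g : SmoothMetric n M}
  {β : (p : M) → TangentSpace (𝓡 n) p →L[ℝ] ℝ} {φ : ℝ → ℝ} {J : Set ℝ}
  {e : OpenPartialHomeomorph M (EuclideanSpace ℝ (Fin n))} {u y : EuclideanSpace ℝ (Fin n)}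

theorem slope_coord : β (e.symm u) (coordVec e u y) / alpha g (e.symm u) (coordVec e u y) =
    slope (coordA g e u) (coordB β e u) y := by
  rw [alpha, inner_coordVec, form_coordVec]
  rfl

theorem IsAlphaBetaMetric.regularAt (hF : IsAlphaBetaMetric g β φ J)
    (he : e ∈ IsManifold.maximalAtlas (𝓡 n) ∞ M) (hu : u ∈ e.target)
    (hy : 0 < quad (coordA g e u) y) (hs : slope (coordA g e u) (coordB β e u) y ∈ J) :
    RegularAt φ (normSq (coordA g e) (coordB β e) u)
      (slope (coordA g e u) (coordB β e u) y) := by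
  have hdet : IsUnit (coordA g e u).det :=
    isUnit_det_of_quad_pos fun y hy => coordA_pos he hu g hy
  have hD : coordVec e u y ∈ finslerDomain g β J (e.symm u) := by
    refine ⟨(coordVec_ne_zero he hu).2 ?_, by rwa [slope_coord]⟩
    rintro rfl
    simp [quad] at hy
  refine ⟨hF.smooth_phi.contDiffAt (hF.isOpen_dom.mem_nhds hs), ?_, ?_, ?_⟩
  · exact slope_coord (g := g) (β := β) ▸ hF.phi_pos _ _ hD
  · exact hF.regular _ _ hD _ slope_coord.symm
  · have h1 := hF.strong_convex _ _ hD _ slope_coord.symm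
      (coordVec e u (WithLp.toLp 2 (bUp (coordA g e) (coordB β e) u))) fun z => by
        obtain ⟨z, rfl⟩ := (coordVec_bijective he hu).2 z
        rw [inner_coordVec, form_coordVec]
        have h2 := congrArg (fun w => w ⬝ᵥ z.ofLp)
          (mulVec_bUp (a := coordA g e) (b := coordB β e) hdet)
        refine Eq.trans ?_ h2
        simp only [dotProduct, Matrix.mulVec, Finset.sum_mul]
        rw [Finset.sum_comm]
        refine Finset.sum_congr rfl fun i _ => Finset.sum_congr rfl fun j _ => ?_
        rw [coordA_symm]
    rw [form_coordVec] at h1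
    exact (dotProduct_bUp (a := coordA g e) (b := coordB β e) (u := u)) ▸ h1

end Chart

end AlphaBeta

end

open AlphaBeta in
/-- The E-curvature of an `(α, β)`-metric `F = α φ(β / α)` in an arbitrary chart `e` of `M`, at the
point with coordinates `u` and the tangent vector `y^i ∂/∂x^i` in the domain of `F`. -/
theorem proposition3p1 {n : ℕ} {M : Type*} [TopologicalSpace M]
    [ChartedSpace (EuclideanSpace ℝ (Fin n)) M] [IsManifold (𝓡 n) ∞ M]
    (g : SmoothMetric n M) (β : (p : M) → TangentSpace (𝓡 n) p →L[ℝ] ℝ)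
    (φ : ℝ → ℝ) (J : Set ℝ) (hF : IsAlphaBetaMetric g β φ J)
    (e : OpenPartialHomeomorph M (EuclideanSpace ℝ (Fin n)))
    (he : e ∈ IsManifold.maximalAtlas (𝓡 n) ∞ M)
    (u : EuclideanSpace ℝ (Fin n)) (hu : u ∈ e.target)
    (y : EuclideanSpace ℝ (Fin n)) (hy : y ∈ coordDomain g β J e u) :
    let L := coordF g β φ e
    let D := coordDomain g β J e
    -- the components of `α`, `β` and the tensors built from them, at the point `u`
    let a : Matrix (Fin n) (Fin n) ℝ := coordA g e u
    let b : Fin n → ℝ := coordB β e u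
    let B : ℝ := normSq (coordA g e) (coordB β e) u
    let r : Fin n → Fin n → ℝ := rTensor (coordA g e) (coordB β e) u
    let r₁ : Fin n → ℝ := rForm (coordA g e) (coordB β e) u
    let s₁ : Fin n → ℝ := sForm (coordA g e) (coordB β e) u
    -- contractions with `y`
    let y₁ : Fin n → ℝ := fun i => ∑ j, a i j * y j
    let ri0 : Fin n → ℝ := fun i => ∑ j, r i j * y j
    let r00 : ℝ := ∑ i, ∑ j, r i j * y i * y j
    let r0 : ℝ := ∑ j, r₁ j * y j
    let s0 : ℝ := ∑ j, s₁ j * y j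
    let α : ℝ := Real.sqrt (∑ i, ∑ j, a i j * y i * y j)
    let s : ℝ := (∑ i, b i * y i) / α
    -- the functions of `s`, and their derivatives in `s`
    let q : ℝ := Q φ s
    let q' : ℝ := deriv (Q φ) s
    let q'' : ℝ := deriv (deriv (Q φ)) s
    let Δ : ℝ := Delta φ B s
    let Φ : ℝ := Phi n φ B s
    let Ψ' : ℝ := deriv (Psi φ B) s
    let Ψ'' : ℝ := deriv (deriv (Psi φ B)) s
    let Ω' : ℝ := deriv (Omega n φ B) s
    let Ω'' : ℝ := deriv (deriv (Omega n φ B)) s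
    let C₁ : ℝ := 1 / (2 * α ^ 3 * Δ ^ 2) *
      (Φ * α * q'' * s0 + 2 * α * Δ ^ 2 * Ψ'' * r0 - Δ ^ 2 * Ω'' * r00
        + 2 * Δ ^ 2 * α * Ω'' * q * s0 + 4 * Δ ^ 2 * α * Ω' * q' * s0
        + 2 * α * Δ ^ 2 * Ψ'' * s0)
    let C₂ : ℝ := -1 / (2 * α ^ 4 * Δ ^ 2) *
      (2 * α * Δ ^ 2 * Ψ' * s0 - 2 * Ω' * Δ ^ 2 * r00 + 2 * Ω' * Δ ^ 2 * α * q * s0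
        - Δ ^ 2 * Ω'' * s * r00 + 2 * Δ ^ 2 * α * Ω'' * s * q * s0
        + 4 * Δ ^ 2 * α * Ω' * q' * s0 * s + 2 * α * Δ ^ 2 * Ψ' * r0
        + 2 * α * Δ ^ 2 * Ψ'' * s * r0 + 2 * α * Δ ^ 2 * Ψ'' * s * s0
        + Φ * α * q' * s0 + Φ * α * q'' * s0 * s)
    let C₃ : ℝ := 1 / (4 * α ^ 5 * Δ ^ 2) *
      (4 * Δ ^ 2 * s ^ 2 * Ω'' * α * q * s0 - 2 * Δ ^ 2 * s ^ 2 * Ω'' * r00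
        + 12 * α * Δ ^ 2 * Ψ' * s * r0 + 12 * α * Δ ^ 2 * Ψ' * s * s0
        + 4 * α * Δ ^ 2 * Ψ'' * s ^ 2 * r0 + 4 * α * Δ ^ 2 * Ψ'' * s ^ 2 * s0
        + 8 * Δ ^ 2 * s ^ 2 * Ω' * α * q' * s0 + 2 * Φ * α * q'' * s0 * s ^ 2
        - 10 * Ω' * Δ ^ 2 * s * r00 + 12 * Ω' * Δ ^ 2 * s * α * q * s0
        + 6 * Φ * α * q' * s0 * s - 3 * Φ * r00)
    let C₄ : ℝ := -1 / (4 * α ^ 3 * Δ ^ 2) *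
      (4 * α * Δ ^ 2 * Ψ' * s * s0 - Φ * r00 - 2 * Ω' * Δ ^ 2 * s * r00
        + 4 * Ω' * Δ ^ 2 * s * α * q * s0 + 4 * α * Δ ^ 2 * Ψ' * s * r0
        + 2 * Φ * α * q' * s0 * s)
    let C₅ : ℝ := -Ω' / α ^ 2
    let C₆ : ℝ := (2 * Δ ^ 2 * s * Ω' + Φ) / (2 * α ^ 3 * Δ ^ 2)
    let C₇ : ℝ := -Φ / (2 * α * Δ ^ 2)
    let C₈ : ℝ := 1 / (2 * α * Δ ^ 2) * (2 * Ω' * Δ ^ 2 * q + 2 * Δ ^ 2 * Ψ' + Φ * q')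
    let C₉ : ℝ := -s / α * C₈
    let C₁₀ : ℝ := Ψ' / α
    let C₁₁ : ℝ := -s / α * C₁₀
    ContDiffAt ℝ ∞ (sCurv D L u) y ∧
    ∀ i j : Fin n, eCurv D L u y i j =
      C₁ * (b i * b j) + C₂ * (b i * y₁ j + b j * y₁ i) + C₃ * (y₁ i * y₁ j) + C₄ * a i j
        + C₅ * (ri0 i * b j + ri0 j * b i) + C₆ * (ri0 i * y₁ j + ri0 j * y₁ i) + C₇ * r i j
        + C₈ * (s₁ i * b j + s₁ j * b i) + C₉ * (s₁ i * y₁ j + s₁ j * y₁ i)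
        + C₁₀ * (r₁ i * b j + r₁ j * b i) + C₁₁ * (r₁ i * y₁ j + r₁ j * y₁ i) := by
  intro L D a b B r r₁ s₁ y₁ ri0 r00 r0 s0 α s q q' q'' Δ Φ Ψ' Ψ'' Ω' Ω'' C₁ C₂ C₃ C₄ C₅ C₆ C₇ C₈ C₉
    C₁₀ C₁₁
  have hL : L = abMetric φ (coordA g e) (coordB β e) :=
    funext fun u' => funext fun y' => coordF_eq g β φ e u' y'
  have hsymm : ∀ u', (coordA g e u').IsSymm := fun u' =>
    Matrix.IsSymm.ext fun i j => coordA_symm g e u' j i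
  have hdet : IsUnit (coordA g e u).det := isUnit_det_of_quad_pos fun y hy => coordA_pos he hu g hy
  have hreg : ∀ y, 0 < quad (coordA g e u) y → slope (coordA g e u) (coordB β e u) y ∈ J →
      RegularAt φ (normSq (coordA g e) (coordB β e) u) (slope (coordA g e u) (coordB β e u) y) :=
    fun y hy hs => hF.regularAt he hu hy hs
  have hy0 : 0 < quad (coordA g e u) y := coordA_pos he hu g ((coordVec_ne_zero he hu).1 hy.1)
  have hs : slope (coordA g e u) (coordB β e u) y ∈ J :=
    slope_coord (g := g) (β := β) ▸ hy.2
  have hS := sCurv_abMetric D hF.isOpen_dom hF.smooth_phi hsymm hdet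
    (differentiableAt_coordA he hu g)
    (differentiableAt_coordB he hu hF.smooth_form) hreg hy0 hs
  rw [hL]
  refine ⟨((contDiffAt_sCurvMain hy0 (hreg y hy0 hs)).add
    (contDiffAt_linear _)).congr_of_eventuallyEq hS, fun i j => ?_⟩
  obtain ⟨c, hH⟩ := hasHess_sCurvMain (hsymm u) hy0 (hreg y hy0 hs)
  -- The linear remainder, holding the Christoffel trace and the density, has zero Hessian.
  have hH' := (hH.add (HasHess.linear fun j => ∑ m, christoffel (coordA g e) u m m j -
    pd j (fun u' => Real.log (bhDensity D (abMetric φ (coordA g e) (coordB β e)) u')) u)).pd_pd_eq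
      i j
  have hα : 0 < α := Real.sqrt_pos.2 hy0
  have hΔ : 0 < Δ := (hreg y hy0 hs).Delta_pos
  have hΩ : Φ = 2 * Δ ^ 2 * Omega n φ B s :=
    (mul_div_cancel₀ Φ (mul_pos two_pos (pow_pos hΔ 2)).ne').symm
  rw [eCurv, pd_pd_congr hS, hH', add_zero, ← mul_assoc, one_div, inv_mul_cancel₀ two_ne_zero,
    one_mul]
  exact sCurvHess_eq hα.ne' hΔ.ne' hΩ s Ψ' Ψ'' Ω' Ω'' q q' q'' r00 r0 s0 (y₁ i) (y₁ j) (b i) (b j)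
    (ri0 i) (ri0 j) (s₁ i) (s₁ j) (r₁ i) (r₁ j) (a i j) (r i j)
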